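/- Let $\Delta$ be the simplex category with face maps $\delta_i$ and degeneracies $\sigma_i$. Fat Delta, $\underline{\Delta}$, is the category whose objects are the epimorphisms $\eta\colon[m]\twoheadrightarrow[n]$ of $\Delta$ and whose morphisms $\eta\to\kappa$ are the commutative squares in $\Delta$ with vertical sides $\eta,\kappa$ whose top map is a monomorphism. The vertices of $\eta\colon[m]\twoheadrightarrow[n]$ are the elements of $[m]$. For $0\le i\le n$ let $\varsigma_i$ be the smallest vertex in the fibre $\eta^{-1}(i)$. A vertex is *standard* if it is the only vertex of its fibre; it is *inner marked* if it has a predecessor and a successor in $[m]$ and all three lie in the same fibre. The *faces* are the following morphisms, given as pairs (top map, bottom map): * the *degenerated face* $d_i=(\mathrm{id},\sigma_i)\colon\eta\to\sigma_i\eta$, for $\eta\colon[m]\twoheadrightarrow[n]$ and $0\le i<n$; * the *vertical face* $v_j=(\delta_j,\mathrm{id})\colon\kappa\delta_j\to\kappa$, for an inner marked vertex $j$ of $\kappa$; * the *standard face* $s_i=(\delta_{\varsigma_i},\delta_i)\colon\eta\to\kappa$, for $\kappa\colon[m]\twoheadrightarrow[n]$ with $n\ge1$ such that $\varsigma_i$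 is a standard vertex of $\kappa$, where $\eta\colon[m-1]\twoheadrightarrow[n-1]$ is $\kappa$ with the vertex $\varsigma_i$ and its image $i$ removed. For $\epsilon\in\{0,1\}$ the *bordering extension* is $b_i^{\epsilon}=d_i s_{i+\epsilon}$. The *fat simplicial relations* are the following relations between formal composites of faces with common source and target: 1. $d_jd_i=d_id_{j+1}$ for $i\le j$; 2. $s_is_j=s_{j+1}s_i$ for $i\le j$; 3. $v_iv_j=v_{j+1}v_i$ for $i\le j$; 4. $s_iv_j=v_{j+1}s_i$ for $\varsigma_i<j$, and $s_iv_j=v_js_i$ for $j<\varsigma_i$, with $\varsigma_i$ taken in the target of $s_i$ on the left; 5. $v_jd_i=d_i\,b_{i+1-\epsilon}^{\epsilon}$ for $j=\varsigma_{i+1}$ and $\epsilon\in\{0,1\}$, and $v_jd_i=d_iv_j$ for $j\neq\varsigma_{i+1}$, with $\varsigma_{i+1}$ taken in the source of $d_i$ on the left; 6. $d_js_i=s_id_{j-1}$ for $i<j$; $d_js_i=b_j^{\epsilon}$ for $i=j+\epsilon$ with $\epsilon\in\{0,1\}$; $d_js_i=s_{i-1}d_j$ for $j+1<i$. **Theorem.**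 Every morphism $f$ of $\underline{\Delta}$ factors as a composite of degenerated, vertical and standard faces, of the form $$f=v_{t_\iota}\cdots v_{t_1}\;b_{i_\alpha}^{\epsilon_\alpha}\cdots b_{i_1}^{\epsilon_1}\;s_{j_\beta}\cdots s_{j_1}\;v_{k_\gamma}\cdots v_{k_1}\;b_{c_\theta}^{\epsilon'_\theta}\cdots b_{c_1}^{\epsilon'_1}\;d_{l_\lambda}\cdots d_{l_1},$$ where any of the six blocks may be empty and in each block the indices are increasing: $l_1\le\dots\le l_\lambda$, the indices of the $s$-block and of each $v$-block increase strictly, and the pairs (index, $\epsilon$) of each $b$-block increase strictly in the lexicographic order. This factorisation is unique up to the fat simplicial relations; moreover, any two factorisations of $f$ as formal composites of faces are connected by a finite chain of steps, each of which applies one of the relations, in either direction, to a subcomposite. Consequently the faces and the fat simplicial relations present $\underline{\Delta}$: the relations hold in $\underline{\Delta}$, and the canonical functor to $\underline{\Delta}$ from the quotient of the free category on the faces by the congruence generated by the relations is bijective on objects and fully faithful, i.e. an isomorphism of categories. -/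

import Mathlib

open CategoryTheory

/-- An object of fat Delta: an epimorphism `η : [dom] ↠ [cod]` of the simplex category. -/
structure FatDelta where
  {dom : ℕ}
  {cod : ℕ}
  map : (SimplexCategory.mk (dom)) ⟶ (SimplexCategory.mk (cod))
  [epi : Epi map]

namespace FatDelta

/-- A morphism of fat Delta: a commutative square whose top map is a monomorphism. -/
@[ext]
structure Hom (X Y : FatDelta) where
  top : (SimplexCategory.mk (X.dom)) ⟶ (SimplexCategory.mk (Y.dom))
  bot : (SimplexCategory.mk (X.cod)) ⟶ (SimplexCategory.mk (Y.cod))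
  mono_top : Mono top
  comm : top ≫ Y.map = X.map ≫ bot

instance : Category FatDelta where
  Hom := Hom
  id X := ⟨𝟙 _, 𝟙 _, inferInstance, by simp⟩
  comp f g := ⟨f.top ≫ g.top, f.bot ≫ g.bot,
    (have := f.mono_top; have := g.mono_top; mono_comp _ _),
    by rw [Category.assoc, g.comm, ← Category.assoc, f.comm, Category.assoc]⟩
  id_comp f := by ext1 <;> exact Category.id_comp _
  comp_id f := by ext1 <;> exact Category.comp_id _
  assoc f g h := by ext1 <;> exact Category.assoc _ _ _

/-- The smallest vertex in the fibre of `X` over `i` (used for `0 ≤ i ≤ X.cod` only). When `i` is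
the image of a standard vertex, this is that vertex. -/
noncomputable def firstVertex (X : FatDelta) (i : ℕ) : ℕ :=
  sInf {x : ℕ | ∃ v : Fin (X.dom + 1), (v : ℕ) = x ∧ (X.map v : ℕ) = i}

/-- The vertex `v` is standard: it is the only vertex of its fibre. -/
def IsStandard {m n : ℕ} (κ : (SimplexCategory.mk m) ⟶ (SimplexCategory.mk n)) (v : Fin (m + 1)) : Prop :=
  ∀ w : Fin (m + 1), κ w = κ v → w = v

/-- The vertex `v` is inner marked: it has an incoming and an outgoing edge, and both are marked,
that is, collapsed by `κ`. -/
def IsInnerMarked {m n : ℕ} (κ : (SimplexCategory.mk m) ⟶ (SimplexCategory.mk n)) (v : Fin (m + 1)) : Prop :=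
  ∃ u w : Fin (m + 1), (u : ℕ) + 1 = v ∧ (v : ℕ) + 1 = w ∧ κ u = κ v ∧ κ v = κ w

/-- `IsDegeneratedFace i f`: the morphism `f` is the degenerated face with index `i`, the square
with top map an identity and bottom map the simplicial degeneracy `σ i`. -/
inductive IsDegeneratedFace : ℕ → ∀ {X Y : FatDelta}, (X ⟶ Y) → Prop
  | mk {m n : ℕ} {η : (SimplexCategory.mk m) ⟶ (SimplexCategory.mk (n + 1))} {κ : (SimplexCategory.mk m) ⟶ (SimplexCategory.mk n)} [Epi η] [Epi κ]
      (f : FatDelta.mk η ⟶ FatDelta.mk κ) (i : Fin (n + 1))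
      (top_eq : f.top = 𝟙 (SimplexCategory.mk m)) (bot_eq : f.bot = SimplexCategory.σ i) :
      IsDegeneratedFace (i : ℕ) f

/-- `IsVerticalFace j f`: the morphism `f` is the vertical face with index `j`, the square with top
map the simplicial face `δ j` and bottom map an identity, where `j` is an inner marked vertex of
the target. -/
inductive IsVerticalFace : ℕ → ∀ {X Y : FatDelta}, (X ⟶ Y) → Prop
  | mk {m n : ℕ} {η : (SimplexCategory.mk m) ⟶ (SimplexCategory.mk n)} {κ : (SimplexCategory.mk (m + 1)) ⟶ (SimplexCategory.mk n)} [Epi η] [Epi κ]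
      (f : FatDelta.mk η ⟶ FatDelta.mk κ) (j : Fin (m + 2)) (inner : IsInnerMarked κ j)
      (top_eq : f.top = SimplexCategory.δ j) (bot_eq : f.bot = 𝟙 (SimplexCategory.mk n)) :
      IsVerticalFace (j : ℕ) f

/-- `IsStandardFace i f`: the morphism `f` is the standard face with index `i`, the square with
bottom map the simplicial face `δ i` and top map the simplicial face `δ v`, where `v` is a standard
vertex of the target lying over `i`. -/
inductive IsStandardFace : ℕ → ∀ {X Y : FatDelta}, (X ⟶ Y) → Prop
  | mk {m n : ℕ} {η : (SimplexCategory.mk m) ⟶ (SimplexCategory.mk n)} {κ : (SimplexCategory.mk (m + 1)) ⟶ (SimplexCategory.mk (n + 1))} [Epi η] [Epi κ]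
      (f : FatDelta.mk η ⟶ FatDelta.mk κ) (i : Fin (n + 2)) (v : Fin (m + 2))
      (map_eq : κ v = i) (standard : IsStandard κ v)
      (top_eq : f.top = SimplexCategory.δ v) (bot_eq : f.bot = SimplexCategory.δ i) :
      IsStandardFace (i : ℕ) f

/-- The generators: the morphisms that are degenerated, vertical or standard faces. The kind and
the index of a face are determined by its underlying morphism. -/
def Face (X Y : FatDelta) : Type :=
  {f : X ⟶ Y // (∃ i, IsDegeneratedFace i f) ∨ (∃ i, IsVerticalFace i f) ∨
    ∃ i, IsStandardFace i f}

/-- The quiver of faces: its vertices are the objects of fat Delta, its arrows are the faces. -/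
def FaceQuiver : Type := FatDelta

instance : Quiver FaceQuiver where
  Hom X Y := Face X Y

/-- The free category on the faces; its morphisms are the formal composites of faces. -/
abbrev FacePaths : Type := Paths FaceQuiver

/-- The formal composites of faces from `X` to `Y`. -/
abbrev FacePath (X Y : FatDelta) : Type := @Quiver.Hom FacePaths _ X Y

/-- The composite in fat Delta of a formal composite of faces. -/
def composite : FacePaths ⥤ FatDelta :=
  Paths.lift
    { obj := fun X : FaceQuiver => (X : FatDelta)
      map := fun e => e.1 }

/-- The path `p` consists of one arrow, the degenerated face with index `i`. -/
def IsD (i : ℕ) {X Y : FacePaths} (p : X ⟶ Y) : Prop :=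
  ∃ e : Face X Y, IsDegeneratedFace i e.1 ∧ p = (Paths.of FaceQuiver).map e

/-- The path `p` consists of one arrow, the vertical face with index `j`. -/
def IsV (j : ℕ) {X Y : FacePaths} (p : X ⟶ Y) : Prop :=
  ∃ e : Face X Y, IsVerticalFace j e.1 ∧ p = (Paths.of FaceQuiver).map e

/-- The path `p` consists of one arrow, the standard face with index `i`. -/
def IsS (i : ℕ) {X Y : FacePaths} (p : X ⟶ Y) : Prop :=
  ∃ e : Face X Y, IsStandardFace i e.1 ∧ p = (Paths.of FaceQuiver).map e

/-- The path `p` is the bordering extension with indices `i` and `ε`: the standard face with index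
`i + ε` followed by the degenerated face with index `i`. -/
def IsB (i : ℕ) (ε : Fin 2) {X Y : FacePaths} (p : X ⟶ Y) : Prop :=
  ∃ (Z : FacePaths) (s : X ⟶ Z) (d : Z ⟶ Y), IsS (i + (ε : ℕ)) s ∧ IsD i d ∧ p = s ≫ d

/-- The six fat simplicial relations. Composites are written in diagrammatic order, so that
`p ≫ q` is the composite `q p` in the usual order. A constructor relates any two composites of the
given shapes that have the same source and the same target. -/
inductive FatRel : HomRel FacePaths
  /-- `d_j d_i = d_i d_{j+1}` for `i ≤ j` -/
  | dd {W X X' Y : FacePaths} {p : W ⟶ X} {q : X ⟶ Y} {p' : W ⟶ X'} {q' : X' ⟶ Y} {i j : ℕ}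
      (hij : i ≤ j) (hp : IsD i p) (hq : IsD j q) (hp' : IsD (j + 1) p') (hq' : IsD i q') :
      FatRel (p ≫ q) (p' ≫ q')
  /-- `s_i s_j = s_{j+1} s_i` for `i ≤ j` -/
  | hh {W X X' Y : FacePaths} {p : W ⟶ X} {q : X ⟶ Y} {p' : W ⟶ X'} {q' : X' ⟶ Y} {i j : ℕ}
      (hij : i ≤ j) (hp : IsS j p) (hq : IsS i q) (hp' : IsS i p') (hq' : IsS (j + 1) q') :
      FatRel (p ≫ q) (p' ≫ q')
  /-- `v_i v_j = v_{j+1} v_i` for `i ≤ j` -/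
  | vv {W X X' Y : FacePaths} {p : W ⟶ X} {q : X ⟶ Y} {p' : W ⟶ X'} {q' : X' ⟶ Y} {i j : ℕ}
      (hij : i ≤ j) (hp : IsV j p) (hq : IsV i q) (hp' : IsV i p') (hq' : IsV (j + 1) q') :
      FatRel (p ≫ q) (p' ≫ q')
  /-- `s_i v_j = v_{j+1} s_i` if `j` is larger than the standard vertex over `i` inserted by
  `s_i` on the left -/
  | hv_gt {W X X' Y : FacePaths} {p : W ⟶ X} {q : X ⟶ Y} {p' : W ⟶ X'} {q' : X' ⟶ Y} {i j : ℕ}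
      (hij : firstVertex Y i < j)
      (hp : IsV j p) (hq : IsS i q) (hp' : IsS i p') (hq' : IsV (j + 1) q') :
      FatRel (p ≫ q) (p' ≫ q')
  /-- `s_i v_j = v_j s_i` if `j` is smaller than the standard vertex over `i` inserted by
  `s_i` on the left -/
  | hv_lt {W X X' Y : FacePaths} {p : W ⟶ X} {q : X ⟶ Y} {p' : W ⟶ X'} {q' : X' ⟶ Y} {i j : ℕ}
      (hij : j < firstVertex Y i)
      (hp : IsV j p) (hq : IsS i q) (hp' : IsS i p') (hq' : IsV j q') :
      FatRel (p ≫ q) (p' ≫ q')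
  /-- `v_j d_i = d_i b_{i+1-ε}^ε` if `v_j` splits the edge marked by `d_i` -/
  | dv_eq {W X X' Y : FacePaths} {p : W ⟶ X} {q : X ⟶ Y} {p' : W ⟶ X'} {q' : X' ⟶ Y} {i j : ℕ}
      {ε : Fin 2} (hij : j = firstVertex W (i + 1))
      (hp : IsD i p) (hq : IsV j q) (hp' : IsB (i + 1 - (ε : ℕ)) ε p') (hq' : IsD i q') :
      FatRel (p ≫ q) (p' ≫ q')
  /-- `v_j d_i = d_i v_j` otherwise -/
  | dv_ne {W X X' Y : FacePaths} {p : W ⟶ X} {q : X ⟶ Y} {p' : W ⟶ X'} {q' : X' ⟶ Y} {i j : ℕ}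
      (hij : j ≠ firstVertex W (i + 1))
      (hp : IsD i p) (hq : IsV j q) (hp' : IsV j p') (hq' : IsD i q') :
      FatRel (p ≫ q) (p' ≫ q')
  /-- `d_j s_i = s_i d_{j-1}` for `i < j` -/
  | hd_lt {W X X' Y : FacePaths} {p : W ⟶ X} {q : X ⟶ Y} {p' : W ⟶ X'} {q' : X' ⟶ Y} {i j : ℕ}
      (hij : i < j) (hp : IsS i p) (hq : IsD j q) (hp' : IsD (j - 1) p') (hq' : IsS i q') :
      FatRel (p ≫ q) (p' ≫ q')
  /-- `d_j s_i = b_j^ε` for `i = j + ε`, the definition of the bordering extension -/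
  | hd_eq {W X Y : FacePaths} {p : W ⟶ X} {q : X ⟶ Y} {r : W ⟶ Y} {i j : ℕ} {ε : Fin 2}
      (hij : i = j + (ε : ℕ)) (hp : IsS i p) (hq : IsD j q) (hr : IsB j ε r) :
      FatRel (p ≫ q) r
  /-- `d_j s_i = s_{i-1} d_j` for `j + 1 < i` -/
  | hd_gt {W X X' Y : FacePaths} {p : W ⟶ X} {q : X ⟶ Y} {p' : W ⟶ X'} {q' : X' ⟶ Y} {i j : ℕ}
      (hij : j + 1 < i) (hp : IsS i p) (hq : IsD j q) (hp' : IsD j p') (hq' : IsS (i - 1) q') :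
      FatRel (p ≫ q) (p' ≫ q')

/-- Two formal composites of faces are equal up to the fat simplicial relations: they are connected
by a finite chain of steps, each of which applies a relation, in either direction, to a
subcomposite. -/
def EqUpToRel {X Y : FacePaths} (p q : X ⟶ Y) : Prop :=
  Relation.EqvGen (HomRel.CompClosure FatRel (X := X) (Y := Y)) p q

/-- `IsChain P l p`: the path `p` is a composite of paths satisfying `P a₁`, …, `P aₖ`, where
`l = [a₁, …, aₖ]` lists the indices in the order in which the pieces are applied, so that in the
usual notation the composite is `f_{aₖ} ⋯ f_{a₁}`. -/
inductive IsChain {ι : Type} (P : ι → ∀ {X Y : FacePaths}, (X ⟶ Y) → Prop) :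
    List ι → ∀ {X Y : FacePaths}, (X ⟶ Y) → Prop
  | nil (X : FacePaths) : IsChain P [] (𝟙 X)
  | cons {X Y Z : FacePaths} {a : ι} {l : List ι} {p : X ⟶ Y} {q : Y ⟶ Z}
      (hp : P a p) (hq : IsChain P l q) : IsChain P (a :: l) (p ≫ q)

/-- `d_{a_k} ⋯ d_{a_1}` with `a_1 ≤ ⋯ ≤ a_k` -/
def IsIncreasingD {X Y : FacePaths} (p : X ⟶ Y) : Prop :=
  ∃ l : List ℕ, l.Pairwise (· ≤ ·) ∧ IsChain (fun i => IsD i) l p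

/-- `v_{a_k} ⋯ v_{a_1}` with `a_1 < ⋯ < a_k` -/
def IsIncreasingV {X Y : FacePaths} (p : X ⟶ Y) : Prop :=
  ∃ l : List ℕ, l.Pairwise (· < ·) ∧ IsChain (fun i => IsV i) l p

/-- `s_{a_k} ⋯ s_{a_1}` with `a_1 < ⋯ < a_k` -/
def IsIncreasingS {X Y : FacePaths} (p : X ⟶ Y) : Prop :=
  ∃ l : List ℕ, l.Pairwise (· < ·) ∧ IsChain (fun i => IsS i) l p

/-- A composite of bordering extensions whose index pairs `(c, ε)` increase strictly in the
lexicographic order -/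
def IsIncreasingB {X Y : FacePaths} (p : X ⟶ Y) : Prop :=
  ∃ l : List (ℕ × Fin 2), l.Pairwise (Prod.Lex (· < ·) (· < ·)) ∧
    IsChain (fun c => IsB c.1 c.2) l p

/-- The formal composite `p` has the form `τ ψ δ ν φ σ` (in the usual order of composition), where
`σ`, `δ` are composites of degenerated and of standard faces, `ν`, `τ` composites of vertical faces
and `φ`, `ψ` composites of bordering extensions, all with increasing indices. -/
def IsFactorisation {X Y : FacePaths} (p : X ⟶ Y) : Prop :=
  ∃ (A B C D E : FacePaths) (σ : X ⟶ A) (φ : A ⟶ B) (ν : B ⟶ C) (δ : C ⟶ D) (ψ : D ⟶ E)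
    (τ : E ⟶ Y),
    IsIncreasingD σ ∧ IsIncreasingB φ ∧ IsIncreasingV ν ∧ IsIncreasingS δ ∧ IsIncreasingB ψ ∧
      IsIncreasingV τ ∧ p = σ ≫ φ ≫ ν ≫ δ ≫ ψ ≫ τ

end FatDelta

/-! ### Monotone maps as functions on natural numbers; morphisms and objects of fat Delta. -/

namespace FatDelta

/-! Call an edge from `k` to `k + 1` marked if both ends lie in one fibre. A morphism is determined
by its top map, since structure maps are epimorphisms (`hom_ext`), and a strictly increasing map of
vertices is a top map exactly when it sends marked edges into fibres (`exists_hom`). Top maps are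
monic, so all morphisms are monic (`eq_of_comp_eq`), and the faces into an object are elementary
subobjects: a vertical or standard face deletes one vertex, a degenerated face unmarks one edge. A
morphism factors through the former iff it misses the vertex, and through the latter iff it sends no
marked edge across the unmarked one (the lemmas `factor` and `avoid`).

Existence (`exists_factorisation`) peels faces off the target. Missed inner marked vertices are
deleted by vertical faces, then missed ends of nontrivial fibres by bordering extensions. The missed
vertices that remain are standard and are deleted by standard faces. What is left is bijective on
vertices and only unmarks edges. Taking the greatest available index each time makes each block
increasing. The inner `b`-block and `v`-block can always be left empty.

The relations hold because both sides have the same top map (`composite_eq_of_fatRel`).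

Uniqueness is a diamond argument on arbitrary formal composites, with no comparison of normal forms.
Two distinct faces `e`, `e'` into `Y`, if some morphism factors through both, have an intersection
that is reached through either of them, and the two resulting formal composites are the two sides of
one relation (`confluent`). The only corner that is not a square of single faces is a marked edge
ending at an inner vertex to be deleted; there a bordering extension appears. If formal composites
ending in `e` and `e'` have the same value, that value factors through the intersection; the factor
is itself a formal composite by existence, and induction on `weight` of the target compares the
parts before `e` and before `e'` (`eqUpToRel_of_eval_eq`). Existence then gives fullness of the
comparison functor, uniqueness its faithfulness. -/

/-- The values of a morphism `[m] ⟶ [n]` of the simplex category as natural numbers; arguments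
beyond `m` are treated as `m`. -/
def value {m n : ℕ} (f : SimplexCategory.mk m ⟶ SimplexCategory.mk n) (k : ℕ) : ℕ :=
  (f.toOrderHom ⟨min k m, Nat.lt_succ_of_le (min_le_right k m)⟩ : Fin (n + 1)).val

lemma apply_val {m n : ℕ} (f : SimplexCategory.mk m ⟶ SimplexCategory.mk n) (v : Fin (m + 1)) :
    (f v : Fin (n + 1)).val = value f v.val := by
  have h : (⟨min v.val m, Nat.lt_succ_of_le (min_le_right _ m)⟩ : Fin (m + 1)) = v :=
    Fin.ext (min_eq_left (Nat.le_of_lt_succ v.isLt))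
  unfold value
  rw [h]
  rfl

lemma value_le {m n : ℕ} (f : SimplexCategory.mk m ⟶ SimplexCategory.mk n) (k : ℕ) :
    value f k ≤ n := Nat.le_of_lt_succ (Fin.isLt _)

lemma value_mono {m n : ℕ} (f : SimplexCategory.mk m ⟶ SimplexCategory.mk n) :
    Monotone (value f) := fun _ _ h =>
  f.toOrderHom.monotone (Fin.mk_le_mk.2 (min_le_min_right m h))

lemma value_id {m k : ℕ} (h : k ≤ m) : value (𝟙 (SimplexCategory.mk m)) k = k :=
  min_eq_left h

lemma value_comp {m n l : ℕ} (f : SimplexCategory.mk m ⟶ SimplexCategory.mk n)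
    (g : SimplexCategory.mk n ⟶ SimplexCategory.mk l) (k : ℕ) :
    value (f ≫ g) k = value g (value f k) := by
  have h : (⟨min (value f k) n, Nat.lt_succ_of_le (min_le_right _ n)⟩ : Fin (n + 1)) =
      f.toOrderHom ⟨min k m, Nat.lt_succ_of_le (min_le_right k m)⟩ :=
    Fin.ext (min_eq_left (value_le f k))
  change _ = (g.toOrderHom ⟨min (value f k) n, Nat.lt_succ_of_le (min_le_right _ n)⟩).val
  rw [h]
  rfl

lemma hom_ext_of_value {m n : ℕ} {f g : SimplexCategory.mk m ⟶ SimplexCategory.mk n}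
    (h : ∀ k ≤ m, value f k = value g k) : f = g := by
  apply SimplexCategory.Hom.ext
  ext v : 2
  apply Fin.ext
  have := h v.val (Nat.le_of_lt_succ v.isLt)
  rwa [← apply_val, ← apply_val] at this

lemma value_δ {n : ℕ} (j : Fin (n + 2)) {k : ℕ} (h : k ≤ n) :
    value (SimplexCategory.δ j) k = if k < j.val then k else k + 1 := by
  have := apply_val (SimplexCategory.δ j) (⟨k, Nat.lt_succ_of_le h⟩ : Fin (n + 1))
  rw [← this]
  change (j.succAbove ⟨k, _⟩).val = _
  unfold Fin.succAbove
  split_ifs with h1 h2 h2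
  · rfl
  · exact absurd h1 h2
  · exact absurd h2 h1
  · rfl

lemma value_σ {n : ℕ} (i : Fin (n + 1)) {k : ℕ} (h : k ≤ n + 1) :
    value (SimplexCategory.σ i) k = if k ≤ i.val then k else k - 1 := by
  have := apply_val (SimplexCategory.σ i) (⟨k, Nat.lt_succ_of_le h⟩ : Fin (n + 2))
  rw [← this]
  change (i.predAbove ⟨k, _⟩).val = _
  unfold Fin.predAbove
  split_ifs with h1 h2 h2
  · exact absurd h1 (not_lt.2 h2)
  · rfl
  · rfl
  · exact absurd (not_le.1 h2) h1

lemma mono_iff_value {m n : ℕ} (f : SimplexCategory.mk m ⟶ SimplexCategory.mk n) :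
    Mono f ↔ ∀ k < m, value f k < value f (k + 1) := by
  rw [SimplexCategory.mono_iff_injective]
  constructor
  · intro h k hk
    refine lt_of_le_of_ne (value_mono f (Nat.le_succ k)) fun e => ?_
    have := congrArg Fin.val (h (Fin.ext e))
    simp only at this
    omega
  · intro h
    have : StrictMono f.toOrderHom := by
      intro a b hab
      have ha : a.val < b.val := hab
      have hb : b.val ≤ m := Nat.le_of_lt_succ b.isLt
      have h1 := h a.val (by omega)
      have h2 := value_mono f (Nat.succ_le_of_lt ha)
      have h3 := apply_val f a
      have h4 := apply_val f b
      change (f a : Fin (n + 1)).val < (f b : Fin (n + 1)).val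
      rw [h3, h4]
      exact lt_of_lt_of_le h1 h2
    exact this.injective

lemma epi_iff_value {m n : ℕ} (f : SimplexCategory.mk m ⟶ SimplexCategory.mk n) :
    Epi f ↔ ∀ i ≤ n, ∃ k ≤ m, value f k = i := by
  rw [SimplexCategory.epi_iff_surjective]
  constructor
  · intro h i hi
    obtain ⟨v, hv⟩ := h ⟨i, Nat.lt_succ_of_le hi⟩
    refine ⟨v.val, Nat.le_of_lt_succ v.isLt, ?_⟩
    rw [← apply_val]
    exact congrArg Fin.val hv
  · intro h i
    obtain ⟨k, hk, e⟩ := h i.val (Nat.le_of_lt_succ i.isLt)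
    refine ⟨⟨k, Nat.lt_succ_of_le hk⟩, Fin.ext ?_⟩
    rw [← e]
    exact apply_val f ⟨k, Nat.lt_succ_of_le hk⟩

/-- A morphism of the simplex category with prescribed values. -/
lemma exists_value {m n : ℕ} (t : ℕ → ℕ) (hm : ∀ k < m, t k ≤ t (k + 1)) (hn : t m ≤ n) :
    ∃ f : SimplexCategory.mk m ⟶ SimplexCategory.mk n, ∀ k ≤ m, value f k = t k := by
  have mono : ∀ a b, a ≤ b → b ≤ m → t a ≤ t b := by
    intro a b hab
    induction b, hab using Nat.le_induction with
    | base => intro _; exact le_rfl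
    | succ b _ ih => intro hb; exact (ih (by omega)).trans (hm b hb)
  refine ⟨SimplexCategory.mkHom ⟨fun v => ⟨t v.val, Nat.lt_succ_of_le
    ((mono _ _ (Nat.le_of_lt_succ v.isLt) le_rfl).trans hn)⟩, fun a b h =>
      mono _ _ h (Nat.le_of_lt_succ b.isLt)⟩, fun k hk => ?_⟩
  change t (min k m) = t k
  rw [min_eq_left hk]

/-- The structure map of `X` on vertices. -/
def ev (X : FatDelta) : ℕ → ℕ := value X.map

/-- The top map of `f` on vertices. -/
def tp {X Y : FatDelta} (f : X ⟶ Y) : ℕ → ℕ := value (Hom.top f)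

/-- The bottom map of `f` on fibres. -/
def bt {X Y : FatDelta} (f : X ⟶ Y) : ℕ → ℕ := value (Hom.bot f)

section Basic

variable (X Y : FatDelta)

lemma ev_le (k : ℕ) : X.ev k ≤ X.cod := value_le _ _

lemma ev_mono : Monotone X.ev := value_mono _

lemma ev_surj {i : ℕ} (hi : i ≤ X.cod) : ∃ k ≤ X.dom, X.ev k = i :=
  (epi_iff_value X.map).1 X.epi i hi

lemma ev_zero : X.ev 0 = 0 := by
  obtain ⟨k, _, hk⟩ := X.ev_surj (Nat.zero_le _)
  have := X.ev_mono (Nat.zero_le k)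
  omega

lemma ev_dom : X.ev X.dom = X.cod := by
  obtain ⟨k, h, hk⟩ := X.ev_surj le_rfl
  have := X.ev_mono h
  have := X.ev_le X.dom
  omega

lemma ev_succ_le (k : ℕ) : X.ev (k + 1) ≤ X.ev k + 1 := by
  by_contra h
  have h1 := X.ev_le (k + 1)
  obtain ⟨l, hl, e⟩ := X.ev_surj (i := X.ev k + 1) (by omega)
  rcases Nat.lt_or_ge k l with h2 | h2
  · have : X.ev (k + 1) ≤ X.ev l := X.ev_mono h2
    omega
  · have := X.ev_mono h2
    omega

lemma ev_le_succ (k : ℕ) : X.ev k ≤ X.ev (k + 1) := X.ev_mono (Nat.le_succ k)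

lemma ev_le_self (k : ℕ) : X.ev k ≤ k := by
  induction k with
  | zero => exact X.ev_zero.le
  | succ k ih => exact (X.ev_succ_le k).trans (Nat.succ_le_succ ih)

lemma cod_le_dom : X.cod ≤ X.dom := by
  rw [← X.ev_dom]
  exact X.ev_le_self _

end Basic

section Homs

variable {X Y Z : FatDelta}

lemma tp_le (f : X ⟶ Y) (k : ℕ) : tp f k ≤ Y.dom := value_le _ _

lemma tp_lt_succ (f : X ⟶ Y) {k : ℕ} (hk : k < X.dom) : tp f k < tp f (k + 1) :=
  (mono_iff_value _).1 f.mono_top k hk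

lemma tp_mono (f : X ⟶ Y) : Monotone (tp f) := value_mono _

lemma tp_id {k : ℕ} (hk : k ≤ X.dom) : tp (𝟙 X) k = k := value_id hk

lemma tp_comp (f : X ⟶ Y) (g : Y ⟶ Z) (k : ℕ) : tp (f ≫ g) k = tp g (tp f k) := value_comp _ _ _

lemma bt_ev (f : X ⟶ Y) (k : ℕ) : bt f (X.ev k) = Y.ev (tp f k) := by
  rw [bt, ev, ← value_comp, ← f.comm, value_comp]
  rfl

lemma ev_tp_eq (f : X ⟶ Y) {k l : ℕ} (h : X.ev k = X.ev l) : Y.ev (tp f k) = Y.ev (tp f l) := by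
  rw [← bt_ev, ← bt_ev, h]

/-- The structure map of the source is epi, so the commuting square forces the bottom map once the
top map is known. -/
lemma hom_ext {f g : X ⟶ Y} (h : ∀ k ≤ X.dom, tp f k = tp g k) : f = g := by
  have ht : Hom.top f = Hom.top g := hom_ext_of_value h
  have := X.epi
  refine Hom.ext ht ?_
  rw [← cancel_epi X.map, ← f.comm, ← g.comm, ht]

lemma eq_of_comp_eq {f g : X ⟶ Y} (e : Y ⟶ Z) (h : f ≫ e = g ≫ e) : f = g := by
  have := e.mono_top
  have ht : Hom.top f = Hom.top g := by
    rw [← cancel_mono (Hom.top e)]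
    exact congrArg Hom.top h
  exact hom_ext fun k _ => congrArg (fun t => value t k) ht

/-- Fibres are intervals, so a condition on adjacent vertices controls whole fibres, and the bottom
map descends along the structure map. -/
lemma exists_hom (t : ℕ → ℕ) (ht : ∀ k < X.dom, t k < t (k + 1)) (hY : t X.dom ≤ Y.dom)
    (h : ∀ k < X.dom, X.ev k = X.ev (k + 1) → Y.ev (t k) = Y.ev (t (k + 1))) :
    ∃ f : X ⟶ Y, ∀ k ≤ X.dom, tp f k = t k := by
  obtain ⟨g, hg⟩ := exists_value t (fun k hk => (ht k hk).le) hY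
  have hmono : Mono g := by
    rw [mono_iff_value]
    intro k hk
    rw [hg k hk.le, hg (k + 1) hk]
    exact ht k hk
  have ker : ∀ a b, a ≤ b → b ≤ X.dom → X.ev a = X.ev b → Y.ev (t a) = Y.ev (t b) := by
    intro a b hab
    induction b, hab using Nat.le_induction with
    | base => intros; rfl
    | succ b hb ih =>
      intro hX e
      have h1 := X.ev_mono hb
      have h2 : X.ev b ≤ X.ev (b + 1) := X.ev_mono (Nat.le_succ b)
      exact (ih (by omega) (by omega)).trans (h b hX (by omega))
  -- An arbitrary section of the structure map; `ker` makes the result independent of it. Beyond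
  -- `X.cod` its value is a dummy.
  choose s hs using fun i : ℕ => show ∃ k, i ≤ X.cod → k ≤ X.dom ∧ X.ev k = i by
    by_cases hi : i ≤ X.cod
    · obtain ⟨k, hk⟩ := X.ev_surj hi
      exact ⟨k, fun _ => hk⟩
    · exact ⟨0, fun h => absurd h hi⟩
  have tmono : ∀ a b, a ≤ b → b ≤ X.dom → t a ≤ t b := by
    intro a b hab hb
    rw [← hg a (hab.trans hb), ← hg b hb]
    exact value_mono g hab
  obtain ⟨b, hb⟩ := exists_value (m := X.cod) (n := Y.cod) (fun i => Y.ev (t (s i)))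
    (fun i hi => by
      have h1 := hs i (by omega)
      have h2 := hs (i + 1) (by omega)
      rcases le_total (s i) (s (i + 1)) with h3 | h3
      · exact Y.ev_mono (tmono _ _ h3 h2.1)
      · have := X.ev_mono h3
        omega) (Y.ev_le _)
  have hc : g ≫ Y.map = X.map ≫ b := by
    apply hom_ext_of_value
    intro k hk
    rw [value_comp, value_comp, hg k hk]
    have h1 := hs (X.ev k) (X.ev_le k)
    refine Eq.trans ?_ (hb (X.ev k) (X.ev_le k)).symm
    rcases le_total k (s (X.ev k)) with h3 | h3
    · exact ker _ _ h3 h1.1 h1.2.symm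
    · exact (ker _ _ h3 hk h1.2).symm
  exact ⟨⟨g, b, hmono, hc⟩, hg⟩

/-- A sequence that starts at 0 and grows by steps of 0 or 1 skips no value, hence defines an
epimorphism. -/
lemma exists_obj (m : ℕ) (e : ℕ → ℕ) (h0 : e 0 = 0)
    (h : ∀ k < m, e k ≤ e (k + 1) ∧ e (k + 1) ≤ e k + 1) :
    ∃ X : FatDelta, X.dom = m ∧ X.cod = e m ∧ ∀ k ≤ m, X.ev k = e k := by
  obtain ⟨g, hg⟩ := exists_value (n := e m) e (fun k hk => (h k hk).1) le_rfl
  have : Epi g := by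
    rw [epi_iff_value]
    have key : ∀ l ≤ m, ∀ i ≤ e l, ∃ k ≤ m, e k = i := by
      intro l
      induction l with
      | zero => intro _ i hi; exact ⟨0, Nat.zero_le _, by omega⟩
      | succ l ih =>
        intro hl i hi
        by_cases h1 : i ≤ e l
        · exact ih (by omega) i h1
        · have := (h l hl).2
          exact ⟨l + 1, hl, by omega⟩
    intro i hi
    obtain ⟨k, hk, e1⟩ := key m le_rfl i hi
    exact ⟨k, hk, (hg k hk).trans e1⟩
  exact ⟨⟨g⟩, rfl, rfl, hg⟩

lemma obj_ext (hd : X.dom = Y.dom) (h : ∀ k ≤ X.dom, X.ev k = Y.ev k) : X = Y := by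
  have hc : X.cod = Y.cod := by rw [← X.ev_dom, ← Y.ev_dom, ← hd, h _ le_rfl]
  obtain ⟨f⟩ := X
  obtain ⟨g⟩ := Y
  dsimp only at hd hc
  subst hd hc
  obtain rfl : f = g := hom_ext_of_value h
  rfl

end Homs

end FatDelta

/-! ### Faces described by the position of the affected edge or vertex. -/

namespace FatDelta

variable {X Y Z : FatDelta}

/-- `f` is the degenerated face that marks the edge from `a` to `a + 1`. -/
structure DAt (a : ℕ) (f : X ⟶ Y) : Prop where
  dom : Y.dom = X.dom
  lt : a < Y.dom
  marked : Y.ev a = Y.ev (a + 1)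
  ev_eq : ∀ k ≤ X.dom, X.ev k = if k ≤ a then Y.ev k else Y.ev k + 1
  tp_eq : ∀ k ≤ X.dom, tp f k = k

/-- `f` is the vertical face that inserts the inner marked vertex `j`. -/
structure VAt (j : ℕ) (f : X ⟶ Y) : Prop where
  dom : Y.dom = X.dom + 1
  pos : 0 < j
  lt : j < Y.dom
  marked : Y.ev (j - 1) = Y.ev (j + 1)
  ev_eq : ∀ k ≤ X.dom, X.ev k = if k < j then Y.ev k else Y.ev (k + 1)
  tp_eq : ∀ k ≤ X.dom, tp f k = if k < j then k else k + 1

/-- `f` is the standard face that inserts the standard vertex `v`. -/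
structure SAt (v : ℕ) (f : X ⟶ Y) : Prop where
  dom : Y.dom = X.dom + 1
  le : v ≤ Y.dom
  left : 0 < v → Y.ev (v - 1) < Y.ev v
  right : v < Y.dom → Y.ev v < Y.ev (v + 1)
  ev_eq : ∀ k ≤ X.dom, X.ev k = if k < v then Y.ev k else Y.ev (k + 1) - 1
  tp_eq : ∀ k ≤ X.dom, tp f k = if k < v then k else k + 1

lemma exists_edge {i : ℕ} (hi : i < X.cod) :
    ∃ a < X.dom, X.ev a = i ∧ X.ev (a + 1) = i + 1 := by
  classical
  have hex : ∃ k, X.ev k = i + 1 := by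
    obtain ⟨k, _, hk⟩ := X.ev_surj (i := i + 1) hi
    exact ⟨k, hk⟩
  obtain ⟨l, hl, el⟩ := X.ev_surj (i := i + 1) hi
  have h1 := Nat.find_spec hex
  have h2 := Nat.find_min' hex el
  have h3 : Nat.find hex ≠ 0 := by
    intro h
    rw [h, X.ev_zero] at h1
    omega
  obtain ⟨a, ha⟩ := Nat.exists_eq_succ_of_ne_zero h3
  have h4 := Nat.find_min hex (m := a) (by omega)
  rw [ha] at h1 h2
  have h5 := X.ev_succ_le a
  have h6 := X.ev_le_succ a
  simp only [Nat.succ_eq_add_one] at h1 h2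
  exact ⟨a, by omega, by omega, h1⟩

lemma bt_comm {m n m' n' : ℕ} {η : SimplexCategory.mk m ⟶ SimplexCategory.mk n}
    {κ : SimplexCategory.mk m' ⟶ SimplexCategory.mk n'} {t : SimplexCategory.mk m ⟶ SimplexCategory.mk m'}
    {b : SimplexCategory.mk n ⟶ SimplexCategory.mk n'} (h : t ≫ κ = η ≫ b) (k : ℕ) :
    value κ (value t k) = value b (value η k) := by
  rw [← value_comp, ← value_comp, h]

lemma hom_ext_bt {f : X ⟶ Y} {b : SimplexCategory.mk X.cod ⟶ SimplexCategory.mk Y.cod}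
    (h : ∀ k ≤ X.dom, value b (X.ev k) = Y.ev (tp f k)) : Hom.bot f = b := by
  apply hom_ext_of_value
  intro i hi
  obtain ⟨k, hk, rfl⟩ := X.ev_surj hi
  rw [h k hk]
  exact bt_ev f k

/-- Merging the fibres over `i` and `i + 1` marks exactly one new edge, the one joining them. The
index alone does not determine this edge from the target, which is why positions are used from here
on. -/
lemma isDegeneratedFace_iff {i : ℕ} {f : X ⟶ Y} :
    IsDegeneratedFace i f ↔ ∃ a, DAt a f ∧ Y.ev a = i := by
  constructor
  · rintro ⟨f, i, top_eq, bot_eq⟩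
    rename_i m n η κ _ _
    have hc : ∀ k ≤ m, value κ k = if value η k ≤ i.val then value η k else value η k - 1 := by
      intro k hk
      have := bt_comm (η := η) (κ := κ) f.comm k
      rwa [top_eq, bot_eq, value_σ i (value_le η k), value_id hk] at this
    obtain ⟨a, ha, h1, h2⟩ := exists_edge (X := FatDelta.mk η) (i := i.val) i.isLt
    change a < m at ha
    change value η a = _ at h1
    change value η (a + 1) = _ at h2
    have h3 := hc a ha.le
    have h4 := hc (a + 1) ha
    refine ⟨a, ⟨rfl, ha, ?_, ?_, ?_⟩, ?_⟩
    · change value κ a = value κ (a + 1)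
      split_ifs at h3 h4 <;> omega
    · intro k hk
      have h5 := hc k hk
      change value η k = if k ≤ a then value κ k else value κ k + 1
      rcases Nat.lt_or_ge a k with h6 | h6
      · have : value η (a + 1) ≤ value η k := value_mono η h6
        split_ifs at h5 ⊢ <;> omega
      · have := value_mono η h6
        split_ifs at h5 ⊢ <;> omega
    · intro k hk
      change value f.top k = k
      rw [top_eq, value_id hk]
    · change value κ a = i.val
      split_ifs at h3 <;> omega
  · rintro ⟨a, h, rfl⟩
    obtain ⟨hd, ha, hm, he, ht⟩ := h
    have hcod : X.cod = Y.cod + 1 := by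
      rw [← X.ev_dom, ← Y.ev_dom, he _ le_rfl, hd, if_neg (by omega)]
    obtain ⟨η⟩ := X
    obtain ⟨κ⟩ := Y
    dsimp only at hd hcod ha he ht
    subst hd hcod
    refine IsDegeneratedFace.mk f ⟨(FatDelta.mk κ).ev a, Nat.lt_succ_of_le (ev_le _ _)⟩ ?_ ?_
    · apply hom_ext_of_value
      intro k hk
      rw [value_id hk]
      exact ht k hk
    · apply hom_ext_bt
      intro k hk
      dsimp only at hk
      have h1 := he k hk
      have h2 := ev_le (FatDelta.mk η) k
      dsimp only at h2
      rw [value_σ _ h2, ht k hk]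
      dsimp only
      rcases Nat.lt_or_ge a k with h6 | h6
      · have : (FatDelta.mk κ).ev (a + 1) ≤ (FatDelta.mk κ).ev k := ev_mono _ h6
        split_ifs at h1 ⊢ <;> omega
      · have := ev_mono (FatDelta.mk κ) h6
        split_ifs at h1 ⊢ <;> omega

lemma isVerticalFace_iff {j : ℕ} {f : X ⟶ Y} : IsVerticalFace j f ↔ VAt j f := by
  constructor
  · rintro ⟨f, j, ⟨u, w, hu, hw, h1, h2⟩, top_eq, bot_eq⟩
    rename_i m n η κ _ _
    have hw' := w.isLt
    have h3 := congrArg Fin.val (h1.trans h2)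
    rw [apply_val, apply_val, show u.val = j.val - 1 by omega, ← hw] at h3
    have ht : ∀ k ≤ m, value f.top k = if k < j.val then k else k + 1 := by
      intro k hk
      rw [top_eq, value_δ j hk]
    refine ⟨rfl, by omega, ?_, h3, ?_, ht⟩
    · change j.val < m + 1
      omega
    · intro k hk
      have := bt_comm (η := η) (κ := κ) f.comm k
      rw [bot_eq, value_id (value_le η k), ht k hk] at this
      change value η k = if k < j.val then value κ k else value κ (k + 1)
      rw [← this]
      split_ifs <;> rfl
  · rintro ⟨hd, hp, hj, hm, he, ht⟩
    have hcod : Y.cod = X.cod := by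
      rw [← X.ev_dom, ← Y.ev_dom, he _ le_rfl, hd, if_neg (by omega)]
    obtain ⟨η⟩ := X
    obtain ⟨κ⟩ := Y
    dsimp only at hd hcod hj he ht
    subst hd hcod
    refine IsVerticalFace.mk f ⟨j, by omega⟩
      ⟨⟨j - 1, by omega⟩, ⟨j + 1, by omega⟩, Nat.sub_add_cancel hp, rfl, ?_, ?_⟩ ?_ ?_
    · apply Fin.ext
      rw [apply_val, apply_val]
      exact le_antisymm (value_mono κ (Nat.sub_le j 1))
        ((value_mono κ (Nat.le_succ j)).trans hm.ge)
    · apply Fin.ext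
      rw [apply_val, apply_val]
      exact le_antisymm (value_mono κ (Nat.le_succ j))
        (hm.ge.trans (value_mono κ (Nat.sub_le j 1)))
    · apply hom_ext_of_value
      intro k hk
      rw [value_δ _ hk]
      exact ht k hk
    · apply hom_ext_bt
      intro k hk
      rw [value_id (ev_le (FatDelta.mk η) k), ht k hk, he k hk]
      split_ifs <;> rfl

/-- By monotonicity, being alone in a fibre is a condition on the two neighbours only. -/
lemma isStandardFace_iff {i : ℕ} {f : X ⟶ Y} :
    IsStandardFace i f ↔ ∃ v, SAt v f ∧ Y.ev v = i := by
  constructor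
  · rintro ⟨f, i, v, map_eq, standard, top_eq, bot_eq⟩
    rename_i m n η κ _ _
    have hv := v.isLt
    have hvi : value κ v.val = i.val := by
      rw [← apply_val, map_eq]
    have ht : ∀ k ≤ m, value f.top k = if k < v.val then k else k + 1 := by
      intro k hk
      rw [top_eq, value_δ v hk]
    have hs : ∀ w, w ≤ m + 1 → value κ w = value κ v.val → w = v.val := by
      intro w hw e
      have := standard ⟨w, by omega⟩ (Fin.ext (by rw [apply_val, apply_val]; exact e))
      exact congrArg Fin.val this
    refine ⟨v.val, ⟨rfl, by dsimp only; omega, ?_, ?_, ?_, ht⟩, hvi⟩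
    · intro hp
      have h1 := hs (v.val - 1) (by omega)
      have h2 := value_mono κ (Nat.sub_le v.val 1)
      change value κ (v.val - 1) < value κ v.val
      omega
    · intro hl
      have h1 := hs (v.val + 1) hl
      have h2 := value_mono κ (Nat.le_succ v.val)
      change value κ v.val < value κ (v.val + 1)
      simp only [Nat.succ_eq_add_one] at h2
      omega
    · intro k hk
      change k ≤ m at hk
      have := bt_comm (η := η) (κ := κ) f.comm k
      rw [bot_eq, value_δ _ (value_le η k), ht k hk] at this
      change value η k = if k < v.val then value κ k else value κ (k + 1) - 1
      rcases Nat.lt_or_ge k v.val with h6 | h6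
      · rw [if_pos h6] at this ⊢
        have h7 := value_mono κ h6.le
        split_ifs at this <;> omega
      · rw [if_neg (by omega)] at this ⊢
        have h7 : value κ v.val ≤ value κ (k + 1) := value_mono κ (by omega)
        have h8 := hs (k + 1) (by omega)
        split_ifs at this <;> omega
  · rintro ⟨v, ⟨hd, hv, hl, hr, he, ht⟩, rfl⟩
    have hcod : Y.cod = X.cod + 1 := by
      have h1 := X.ev_dom
      have h2 := Y.ev_dom
      rw [he _ le_rfl] at h1
      rw [hd] at h2
      split_ifs at h1 with h3
      · have h4 := hl (by omega)
        rw [show v = X.dom + 1 by omega, Nat.add_sub_cancel] at h4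
        have := Y.ev_succ_le X.dom
        omega
      · have h4 := hr (by omega)
        have : Y.ev (v + 1) ≤ Y.ev (X.dom + 1) := Y.ev_mono (by omega)
        omega
    obtain ⟨η⟩ := X
    obtain ⟨κ⟩ := Y
    dsimp only at hd hcod hv hl hr he ht
    subst hd hcod
    have hκ := (FatDelta.mk κ).ev_mono
    refine IsStandardFace.mk f ⟨(FatDelta.mk κ).ev v, Nat.lt_succ_of_le (ev_le _ _)⟩
      ⟨v, by omega⟩ (Fin.ext (apply_val κ _)) ?_ ?_ ?_
    · intro w hw
      have hw1 := w.isLt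
      have h1 := congrArg Fin.val hw
      rw [apply_val, apply_val] at h1
      change (FatDelta.mk κ).ev w.val = (FatDelta.mk κ).ev v at h1
      apply Fin.ext
      change w.val = v
      rcases Nat.lt_trichotomy w.val v with h2 | h2 | h2
      · have h3 := hl (by omega)
        have := hκ (show w.val ≤ v - 1 by omega)
        omega
      · exact h2
      · have h3 := hr (by omega)
        have := hκ (show v + 1 ≤ w.val by omega)
        omega
    · apply hom_ext_of_value
      intro k hk
      rw [value_δ _ hk]
      exact ht k hk
    · apply hom_ext_bt
      intro k hk
      dsimp only at hk
      have h1 := he k hk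
      rw [value_δ _ (ev_le (FatDelta.mk η) k), ht k hk]
      dsimp only
      rcases Nat.lt_or_ge k v with h6 | h6
      · rw [if_pos h6] at h1 ⊢
        have h7 := hl (by omega)
        have h8 := hκ (show k ≤ v - 1 by omega)
        split_ifs <;> omega
      · rw [if_neg (not_lt.2 h6)] at h1 ⊢
        have h7 := hr (by omega)
        have h8 : (FatDelta.mk κ).ev (v + 1) ≤ (FatDelta.mk κ).ev (k + 1) := hκ (by omega)
        split_ifs <;> omega

/-- A morphism to `Y` factors through any morphism whose values and structure map are compatible
with it. -/
lemma exists_factor {f : X ⟶ Y} {e : Z ⟶ Y} (t : ℕ → ℕ)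
    (ht : ∀ k ≤ X.dom, t k ≤ Z.dom ∧ tp e (t k) = tp f k)
    (h : ∀ k < X.dom, X.ev k = X.ev (k + 1) → Z.ev (t k) = Z.ev (t (k + 1))) :
    ∃ g : X ⟶ Z, g ≫ e = f ∧ ∀ k ≤ X.dom, tp g k = t k := by
  have hlt : ∀ k < X.dom, t k < t (k + 1) := by
    intro k hk
    by_contra h1
    have h2 := tp_mono e (not_lt.1 h1)
    have h3 := tp_lt_succ f hk
    rw [(ht (k + 1) hk).2, (ht k hk.le).2] at h2
    omega
  obtain ⟨g, hg⟩ := exists_hom t hlt (ht _ le_rfl).1 h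
  refine ⟨g, hom_ext fun k hk => ?_, hg⟩
  rw [tp_comp, hg k hk, (ht k hk).2]

end FatDelta

/-! ### Existence of faces into an object, and criteria for factoring through them. -/

namespace FatDelta

variable {X Y Z : FatDelta}

lemma exists_dAt (Y : FatDelta) {a : ℕ} (ha : a < Y.dom) (h : Y.ev a = Y.ev (a + 1)) :
    ∃ (X : FatDelta) (f : X ⟶ Y), DAt a f := by
  obtain ⟨X, hd, -, he⟩ := exists_obj Y.dom (fun k => if k ≤ a then Y.ev k else Y.ev k + 1)
    (by simp [Y.ev_zero]) (by
      intro k _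
      have h1 := Y.ev_le_succ k
      have h2 := Y.ev_succ_le k
      rcases Nat.lt_trichotomy k a with h3 | rfl | h3
      · simp only [if_pos h3.le, if_pos (show k + 1 ≤ a from h3)]
        omega
      · simp only [le_refl, if_true, if_neg (Nat.not_succ_le_self k)]
        omega
      · simp only [if_neg (not_le.2 h3), if_neg (show ¬ k + 1 ≤ a by omega)]
        omega)
  rw [← hd] at he
  obtain ⟨f, hf⟩ := exists_hom (X := X) (Y := Y) (fun k => k) (fun k _ => Nat.lt_succ_self k)
    hd.le (by
      intro k hk e
      rw [he k hk.le, he (k + 1) hk] at e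
      have h1 := Y.ev_le_succ k
      split_ifs at e <;> omega)
  exact ⟨X, f, hd.symm, ha, h, he, hf⟩

lemma exists_vAt (Y : FatDelta) {j : ℕ} (hp : 0 < j) (hj : j < Y.dom)
    (h : Y.ev (j - 1) = Y.ev (j + 1)) : ∃ (X : FatDelta) (f : X ⟶ Y), VAt j f := by
  obtain ⟨X, hd, -, he⟩ := exists_obj (Y.dom - 1)
    (fun k => if k < j then Y.ev k else Y.ev (k + 1))
    (by simp [hp, Y.ev_zero]) (by
      intro k _
      have h1 := Y.ev_le_succ k
      have h2 := Y.ev_succ_le k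
      have h3 := Y.ev_le_succ (k + 1)
      have h4 := Y.ev_succ_le (k + 1)
      rcases Nat.lt_trichotomy (k + 1) j with h5 | h5 | h5
      · simp only [if_pos h5, if_pos (show k < j by omega)]
        omega
      · rw [← h5, Nat.add_sub_cancel] at h
        simp only [if_pos (show k < j by omega), if_neg (show ¬ k + 1 < j by omega)]
        omega
      · simp only [if_neg (show ¬ k + 1 < j by omega), if_neg (show ¬ k < j by omega)]
        omega)
  rw [← hd] at he
  obtain ⟨f, hf⟩ := exists_hom (X := X) (Y := Y) (fun k => if k < j then k else k + 1)
    (by intro k _; split_ifs <;> omega) (by split_ifs <;> omega) (by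
      intro k hk e
      rw [he k hk.le, he (k + 1) hk] at e
      split_ifs at e ⊢ <;> exact e)
  exact ⟨X, f, by omega, hp, hj, h, he, hf⟩

/-- The condition `0 < Y.dom` ensures that a vertex is left after the deletion. -/
lemma exists_sAt (Y : FatDelta) {v : ℕ} (hd : 0 < Y.dom) (hv : v ≤ Y.dom)
    (hl : 0 < v → Y.ev (v - 1) < Y.ev v) (hr : v < Y.dom → Y.ev v < Y.ev (v + 1)) :
    ∃ (X : FatDelta) (f : X ⟶ Y), SAt v f := by
  have hpos : ∀ k, v ≤ k → k < Y.dom → 0 < Y.ev (k + 1) := by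
    intro k h1 h2
    have h3 := hr (by omega)
    have h4 : Y.ev (v + 1) ≤ Y.ev (k + 1) := Y.ev_mono (by omega)
    omega
  obtain ⟨X, hd, -, he⟩ := exists_obj (Y.dom - 1)
    (fun k => if k < v then Y.ev k else Y.ev (k + 1) - 1)
    (by
      have := Y.ev_zero
      have := Y.ev_succ_le 0
      split_ifs <;> omega) (by
      intro k hk
      have h1 := Y.ev_le_succ k
      have h2 := Y.ev_succ_le k
      have h3 := Y.ev_le_succ (k + 1)
      have h4 := Y.ev_succ_le (k + 1)
      rcases Nat.lt_trichotomy (k + 1) v with h5 | h5 | h5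
      · simp only [if_pos h5, if_pos (show k < v by omega)]
        omega
      · rw [← h5] at hl hr
        rw [Nat.add_sub_cancel] at hl
        have := hl (by omega)
        have := hr (by omega)
        simp only [if_pos (show k < v by omega), if_neg (show ¬ k + 1 < v by omega)]
        omega
      · simp only [if_neg (show ¬ k + 1 < v by omega), if_neg (show ¬ k < v by omega)]
        omega)
  rw [← hd] at he
  obtain ⟨f, hf⟩ := exists_hom (X := X) (Y := Y) (fun k => if k < v then k else k + 1)
    (by intro k _; split_ifs <;> omega) (by split_ifs <;> omega) (by
      intro k hk e
      rw [he k hk.le, he (k + 1) hk] at e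
      have h1 := hpos k
      have h2 := hpos (k + 1)
      split_ifs at e ⊢ with h3 h4 h4
      · exact e
      · obtain rfl : k + 1 = v := by omega
        have h5 := hl (by omega)
        have h6 := hr (by omega)
        rw [Nat.add_sub_cancel] at h5
        omega
      · omega
      · have := h1 (by omega) (by omega)
        have := h2 (by omega) (by omega)
        omega)
  exact ⟨X, f, by omega, hv, hl, hr, he, hf⟩

/-- Unmarking cuts a fibre between `a` and `a + 1`; the only obstruction is a marked edge of `X`
that is sent across the cut. `DAt.avoid` is the converse. -/
lemma DAt.factor {a : ℕ} {e : Z ⟶ Y} (he : DAt a e) (f : X ⟶ Y)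
    (h : ∀ k < X.dom, X.ev k = X.ev (k + 1) → tp f k ≤ a → tp f (k + 1) ≤ a) :
    ∃ g : X ⟶ Z, g ≫ e = f ∧ ∀ k ≤ X.dom, tp g k = tp f k := by
  have hle : ∀ k, tp f k ≤ Z.dom := fun k => he.dom ▸ tp_le f k
  refine exists_factor (tp f) (fun k _ => ⟨hle k, he.tp_eq _ (hle k)⟩) fun k hk hX => ?_
  rw [he.ev_eq _ (hle k), he.ev_eq _ (hle _), ev_tp_eq f hX]
  have h1 := h k hk hX
  have h2 := tp_lt_succ f hk
  split_ifs <;> omega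

lemma VAt.factor {j : ℕ} {e : Z ⟶ Y} (he : VAt j e) (f : X ⟶ Y)
    (h : ∀ k ≤ X.dom, tp f k ≠ j) :
    ∃ g : X ⟶ Z, g ≫ e = f ∧
      ∀ k ≤ X.dom, tp g k = if tp f k < j then tp f k else tp f k - 1 := by
  have hlt := he.lt
  have hdom := he.dom
  have key : ∀ k ≤ X.dom, (if tp f k < j then tp f k else tp f k - 1) ≤ Z.dom ∧
      (if (if tp f k < j then tp f k else tp f k - 1) < j then
        (if tp f k < j then tp f k else tp f k - 1)
        else (if tp f k < j then tp f k else tp f k - 1) + 1) = tp f k := by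
    intro k hk
    have := tp_le f k
    have := h k hk
    split_ifs <;> omega
  refine exists_factor _ (fun k hk => ⟨(key k hk).1, ?_⟩) fun k hk hX => ?_
  · rw [he.tp_eq _ (key k hk).1]
    exact (key k hk).2
  · have h1 : ∀ k ≤ X.dom, Z.ev (if tp f k < j then tp f k else tp f k - 1) = Y.ev (tp f k) := by
      intro k hk
      rw [he.ev_eq _ (key k hk).1, ← apply_ite Y.ev, (key k hk).2]
    rw [h1 k hk.le, h1 (k + 1) hk, ev_tp_eq f hX]

/-- The whole fibre of `v` disappears and later fibres move down by one. This breaks no marked edge: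
one sent across `v` would have its ends in different fibres of `Y`. -/
lemma SAt.factor {v : ℕ} {e : Z ⟶ Y} (he : SAt v e) (f : X ⟶ Y)
    (h : ∀ k ≤ X.dom, tp f k ≠ v) :
    ∃ g : X ⟶ Z, g ≫ e = f ∧
      ∀ k ≤ X.dom, tp g k = if tp f k < v then tp f k else tp f k - 1 := by
  have hdom := he.dom
  have hle := he.le
  have key : ∀ k ≤ X.dom, (if tp f k < v then tp f k else tp f k - 1) ≤ Z.dom ∧
      (if (if tp f k < v then tp f k else tp f k - 1) < v then
        (if tp f k < v then tp f k else tp f k - 1)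
        else (if tp f k < v then tp f k else tp f k - 1) + 1) = tp f k := by
    intro k hk
    have := tp_le f k
    have := h k hk
    split_ifs <;> omega
  refine exists_factor _ (fun k hk => ⟨(key k hk).1, ?_⟩) fun k hk hX => ?_
  · rw [he.tp_eq _ (key k hk).1]
    exact (key k hk).2
  · have h1 : ∀ k ≤ X.dom, Z.ev (if tp f k < v then tp f k else tp f k - 1) =
        if tp f k < v then Y.ev (tp f k) else Y.ev (tp f k) - 1 := by
      intro k hk
      have := h k hk
      rw [he.ev_eq _ (key k hk).1]
      by_cases h2 : tp f k < v
      · simp only [if_pos h2]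
      · simp only [if_neg h2, if_neg (show ¬ tp f k - 1 < v by omega)]
        rw [Nat.sub_add_cancel (by omega)]
    rw [h1 k hk.le, h1 (k + 1) hk]
    have h2 := ev_tp_eq f hX
    have h3 := h k hk.le
    have h4 := h (k + 1) hk
    have h5 := tp_lt_succ f hk
    split_ifs with h6 h7 h7
    · exact h2
    · have h8 := he.left (by omega)
      have h9 : Y.ev (tp f k) ≤ Y.ev (v - 1) := Y.ev_mono (by omega)
      have h10 : Y.ev v ≤ Y.ev (tp f (k + 1)) := Y.ev_mono (by omega)
      omega
    · omega
    · rw [h2]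

lemma DAt.avoid {a : ℕ} {e : Z ⟶ Y} (he : DAt a e) (g : X ⟶ Z) {k : ℕ}
    (hX : X.ev k = X.ev (k + 1)) (h : tp (g ≫ e) k ≤ a) : tp (g ≫ e) (k + 1) ≤ a := by
  have h1 := ev_tp_eq g hX
  have h2 := tp_mono g (Nat.le_succ k)
  rw [he.ev_eq _ (tp_le _ _), he.ev_eq _ (tp_le _ _)] at h1
  rw [tp_comp, he.tp_eq _ (tp_le _ _)] at h ⊢
  have h3 := Y.ev_mono h2
  split_ifs at h1 <;> simp only [Nat.succ_eq_add_one] at * <;> omega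

lemma VAt.avoid {j : ℕ} {e : Z ⟶ Y} (he : VAt j e) (g : X ⟶ Z) (k : ℕ) : tp (g ≫ e) k ≠ j := by
  rw [tp_comp, he.tp_eq _ (tp_le _ _)]
  split_ifs <;> omega

lemma SAt.avoid {v : ℕ} {e : Z ⟶ Y} (he : SAt v e) (g : X ⟶ Z) (k : ℕ) : tp (g ≫ e) k ≠ v := by
  rw [tp_comp, he.tp_eq _ (tp_le _ _)]
  split_ifs <;> omega

lemma firstVertex_eq {i v : ℕ} (hv : v ≤ X.dom) (h : X.ev v = i)
    (hl : 0 < v → X.ev (v - 1) < X.ev v) : firstVertex X i = v := by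
  have hmem : ∀ x, x ∈ {x : ℕ | ∃ v : Fin (X.dom + 1), (v : ℕ) = x ∧ (X.map v : ℕ) = i} ↔
      x ≤ X.dom ∧ X.ev x = i := by
    intro x
    constructor
    · rintro ⟨w, rfl, hw⟩
      exact ⟨Nat.le_of_lt_succ w.isLt, by rw [ev, ← apply_val]; exact hw⟩
    · rintro ⟨hx, e⟩
      exact ⟨⟨x, Nat.lt_succ_of_le hx⟩, rfl, by rw [apply_val]; exact e⟩
  have h1 := Nat.sInf_mem (s := {x : ℕ | ∃ v : Fin (X.dom + 1), (v : ℕ) = x ∧ (X.map v : ℕ) = i})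
    ⟨v, (hmem v).2 ⟨hv, h⟩⟩
  have h2 : firstVertex X i ≤ v := Nat.sInf_le ((hmem v).2 ⟨hv, h⟩)
  have h3 : X.ev (firstVertex X i) = i := ((hmem _).1 h1).2
  by_contra h4
  have h5 := hl (by omega)
  have h6 : X.ev (firstVertex X i) ≤ X.ev (v - 1) := X.ev_mono (by omega)
  omega

end FatDelta

/-! ### Intersections of two faces with a common target. -/

namespace FatDelta

variable {W A B Y : FatDelta}

/-- The square `p ≫ e = p' ≫ e'` commutes, and every pair of morphisms that agree in `Y` factors
through its source. -/
def IsMeet (p : W ⟶ A) (e : A ⟶ Y) (p' : W ⟶ B) (e' : B ⟶ Y) : Prop :=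
  p ≫ e = p' ≫ e' ∧
    ∀ (X : FatDelta) (g : X ⟶ A) (g' : X ⟶ B), g ≫ e = g' ≫ e' → ∃ h : X ⟶ W, h ≫ p = g

/-- The pattern of all the meets below: perform the operation of `e'` on `A` to obtain `W`, get the
other side from the factorisation criterion for `e'`, and prove universality by transporting through
`e` what `e'` forces a morphism to avoid. -/
lemma exists_meet_dd {a b : ℕ} {e : A ⟶ Y} {e' : B ⟶ Y} (he : DAt a e) (he' : DAt b e')
    (hab : a < b) : ∃ (W : FatDelta) (p : W ⟶ A) (p' : W ⟶ B),
      DAt b p ∧ DAt a p' ∧ IsMeet p e p' e' := by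
  have hA := he.dom
  have hB := he'.dom
  have hb := he'.lt
  have hm := he.marked
  have hm' := he'.marked
  obtain ⟨W, p, hp⟩ := exists_dAt A (a := b) (by omega) (by
    rw [he.ev_eq _ (by omega), he.ev_eq _ (by omega), if_neg (by omega), if_neg (by omega), hm'])
  have hW := hp.dom
  have htp : ∀ k ≤ W.dom, tp (p ≫ e) k = k := by
    intro k hk
    rw [tp_comp, hp.tp_eq k hk, he.tp_eq k (by omega)]
  obtain ⟨p', hc, ht⟩ := he'.factor (p ≫ e) (by
    intro k hk h1
    rw [htp k hk.le, htp (k + 1) hk]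
    rw [hp.ev_eq k hk.le, hp.ev_eq (k + 1) hk] at h1
    have := A.ev_le_succ k
    split_ifs at h1 <;> omega)
  refine ⟨W, p, p', hp, ⟨by omega, by omega, ?_, ?_, ?_⟩, hc.symm, ?_⟩
  · rw [he'.ev_eq _ (by omega), he'.ev_eq _ (by omega), if_pos (by omega), if_pos (by omega), hm]
  · intro k hk
    rw [hp.ev_eq k hk, he.ev_eq k (by omega), he'.ev_eq k (by omega)]
    split_ifs <;> omega
  · intro k hk
    rw [ht k hk, htp k hk]
  · intro X g g' hg
    obtain ⟨h, hh, -⟩ := hp.factor g (by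
      intro k hk h1 h2
      have h3 := he'.avoid g' h1
      rw [← hg, tp_comp, tp_comp, he.tp_eq _ (tp_le _ _), he.tp_eq _ (tp_le _ _)] at h3
      exact h3 h2)
    exact ⟨h, hh⟩

lemma exists_meet_vv {u w : ℕ} {e : A ⟶ Y} {e' : B ⟶ Y} (he : VAt u e) (he' : VAt (w + 1) e')
    (huw : u ≤ w) : ∃ (W : FatDelta) (p : W ⟶ A) (p' : W ⟶ B),
      VAt w p ∧ VAt u p' ∧ IsMeet p e p' e' := by
  have hA := he.dom
  have hB := he'.dom
  have hu := he.pos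
  have hv := he'.lt
  have hm := he.marked
  have hm' := he'.marked
  rw [Nat.add_sub_cancel] at hm'
  have hY := Y.ev_le_succ
  have hu1 := hY (u - 1)
  rw [Nat.sub_add_cancel hu] at hu1
  have hu2 := hY u
  obtain ⟨W, p, hp⟩ := exists_vAt A (j := w) (by omega) (by omega) (by
    rw [he.ev_eq _ (by omega), he.ev_eq _ (by omega), if_neg (show ¬ w + 1 < u by omega)]
    split_ifs with h1
    · obtain rfl : u = w := by omega
      omega
    · rw [Nat.sub_add_cancel (by omega), hm'])
  have hW := hp.dom
  have htp : ∀ k ≤ W.dom, tp (p ≫ e) k =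
      if k < u then k else if k < w then k + 1 else k + 2 := by
    intro k hk
    rw [tp_comp, hp.tp_eq k hk, he.tp_eq _ (by split_ifs <;> omega)]
    split_ifs <;> omega
  obtain ⟨p', hc, ht⟩ := he'.factor (p ≫ e) (by
    intro k hk
    rw [htp k hk]
    split_ifs <;> omega)
  refine ⟨W, p, p', hp, ⟨by omega, by omega, by omega, ?_, ?_, ?_⟩, hc.symm, ?_⟩
  · rw [he'.ev_eq _ (by omega), he'.ev_eq _ (by omega), if_pos (by omega)]
    split_ifs with h1
    · exact hm
    · obtain rfl : u = w := by omega
      omega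
  · intro k hk
    rw [hp.ev_eq k hk, he.ev_eq k (by omega), he.ev_eq (k + 1) (by omega), he'.ev_eq k (by omega),
      he'.ev_eq (k + 1) (by omega)]
    split_ifs <;> first | rfl | omega
  · intro k hk
    rw [ht k hk, htp k hk]
    split_ifs <;> omega
  · intro X g g' hg
    obtain ⟨h, hh, -⟩ := hp.factor g (by
      intro k hk h1
      refine he'.avoid g' k ?_
      rw [← hg, tp_comp, he.tp_eq _ (tp_le _ _), h1, if_neg (by omega)])
    exact ⟨h, hh⟩

/-- If `Y` had just the two vertices to be deleted, the intersection would be empty; `hpos` excludes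
this. -/
lemma exists_meet_ss {u w : ℕ} {e : A ⟶ Y} {e' : B ⟶ Y} (he : SAt u e) (he' : SAt (w + 1) e')
    (huw : u ≤ w) (hpos : 0 < A.dom) : ∃ (W : FatDelta) (p : W ⟶ A) (p' : W ⟶ B),
      SAt w p ∧ SAt u p' ∧ IsMeet p e p' e' := by
  have hA := he.dom
  have hB := he'.dom
  have hv := he'.le
  have hr := he.right (by omega)
  have hl' := he'.left (by omega)
  rw [Nat.add_sub_cancel] at hl'
  have hr1 : ∀ k, u < k → Y.ev (u + 1) ≤ Y.ev k := fun k h => Y.ev_mono h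
  obtain ⟨W, p, hp⟩ := exists_sAt A (v := w) hpos (by omega) (by
      intro hw
      have hl := he.left
      have h1 := hr1 w
      rw [he.ev_eq _ (by omega), he.ev_eq _ (by omega), if_neg (show ¬ w < u by omega)]
      split_ifs with h1
      · obtain rfl : u = w := by omega
        have := hl (by omega)
        omega
      · rw [Nat.sub_add_cancel hw]
        omega) (by
      intro hw
      have hr' := he'.right (by omega)
      have h1 := hr1 (w + 1)
      rw [he.ev_eq _ (by omega), he.ev_eq _ (by omega), if_neg (show ¬ w < u by omega),
        if_neg (by omega)]
      omega)
  have hW := hp.dom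
  have htp : ∀ k ≤ W.dom, tp (p ≫ e) k =
      if k < u then k else if k < w then k + 1 else k + 2 := by
    intro k hk
    rw [tp_comp, hp.tp_eq k hk, he.tp_eq _ (by split_ifs <;> omega)]
    split_ifs <;> omega
  obtain ⟨p', hc, ht⟩ := he'.factor (p ≫ e) (by
    intro k hk
    rw [htp k hk]
    split_ifs <;> omega)
  refine ⟨W, p, p', hp, ⟨by omega, by omega, ?_, ?_, ?_, ?_⟩, hc.symm, ?_⟩
  · intro hu
    have hl := he.left hu
    rw [he'.ev_eq _ (by omega), he'.ev_eq _ (by omega), if_pos (by omega), if_pos (by omega)]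
    exact hl
  · intro hu
    rw [he'.ev_eq _ (by omega), he'.ev_eq _ (by omega), if_pos (by omega)]
    split_ifs with h1
    · exact hr
    · obtain rfl : u = w := by omega
      have hr' := he'.right (by omega)
      omega
  · intro k hk
    rw [hp.ev_eq k hk, he.ev_eq k (by omega), he.ev_eq (k + 1) (by omega), he'.ev_eq k (by omega),
      he'.ev_eq (k + 1) (by omega)]
    split_ifs <;> first | rfl | omega
  · intro k hk
    rw [ht k hk, htp k hk]
    split_ifs <;> omega
  · intro X g g' hg
    obtain ⟨h, hh, -⟩ := hp.factor g (by
      intro k hk h1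
      refine he'.avoid g' k ?_
      rw [← hg, tp_comp, he.tp_eq _ (tp_le _ _), h1, if_neg (by omega)])
    exact ⟨h, hh⟩

/-- The inequality becomes strict because the predecessor `w` of an inner marked vertex shares its
fibre, so `w` is not standard. Strictness is what the relation `hv_gt` asks for. -/
lemma exists_meet_sv_of_lt {u w : ℕ} {e : A ⟶ Y} {e' : B ⟶ Y} (he : SAt u e)
    (he' : VAt (w + 1) e') (huw : u ≤ w) : u < w ∧
      ∃ (W : FatDelta) (p : W ⟶ A) (p' : W ⟶ B), VAt w p ∧ SAt u p' ∧ IsMeet p e p' e' := by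
  have hA := he.dom
  have hB := he'.dom
  have hv := he'.lt
  have hr := he.right (by omega)
  have hm' := he'.marked
  rw [Nat.add_sub_cancel] at hm'
  have hY := Y.ev_le_succ
  have hw1 := hY w
  have hw2 := hY (w + 1)
  have huw' : u < w := by
    rcases Nat.lt_or_ge u w with h | h
    · exact h
    · obtain rfl : u = w := by omega
      omega
  refine ⟨huw', ?_⟩
  obtain ⟨W, p, hp⟩ := exists_vAt A (j := w) (by omega) (by omega) (by
    rw [he.ev_eq _ (by omega), he.ev_eq _ (by omega), if_neg (show ¬ w + 1 < u by omega),
      if_neg (by omega), Nat.sub_add_cancel (by omega), hm'])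
  have hW := hp.dom
  have htp : ∀ k ≤ W.dom, tp (p ≫ e) k =
      if k < u then k else if k < w then k + 1 else k + 2 := by
    intro k hk
    rw [tp_comp, hp.tp_eq k hk, he.tp_eq _ (by split_ifs <;> omega)]
    split_ifs <;> omega
  obtain ⟨p', hc, ht⟩ := he'.factor (p ≫ e) (by
    intro k hk
    rw [htp k hk]
    split_ifs <;> omega)
  refine ⟨W, p, p', hp, ⟨by omega, by omega, ?_, ?_, ?_, ?_⟩, hc.symm, ?_⟩
  · intro hu
    have hl := he.left hu
    rw [he'.ev_eq _ (by omega), he'.ev_eq _ (by omega), if_pos (by omega), if_pos (by omega)]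
    exact hl
  · intro hu
    rw [he'.ev_eq _ (by omega), he'.ev_eq _ (by omega), if_pos (by omega), if_pos (by omega)]
    exact hr
  · intro k hk
    rw [hp.ev_eq k hk, he.ev_eq k (by omega), he.ev_eq (k + 1) (by omega), he'.ev_eq k (by omega),
      he'.ev_eq (k + 1) (by omega)]
    split_ifs <;> first | rfl | omega
  · intro k hk
    rw [ht k hk, htp k hk]
    split_ifs <;> omega
  · intro X g g' hg
    obtain ⟨h, hh, -⟩ := hp.factor g (by
      intro k hk h1
      refine he'.avoid g' k ?_
      rw [← hg, tp_comp, he.tp_eq _ (tp_le _ _), h1, if_neg (by omega)])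
    exact ⟨h, hh⟩

lemma exists_meet_sv_of_gt {u v : ℕ} {e : A ⟶ Y} {e' : B ⟶ Y} (he : SAt (u + 1) e)
    (he' : VAt v e') (hvu : v ≤ u) : v < u ∧
      ∃ (W : FatDelta) (p : W ⟶ A) (p' : W ⟶ B), VAt v p ∧ SAt u p' ∧ IsMeet p e p' e' := by
  have hA := he.dom
  have hB := he'.dom
  have hu := he.le
  have hv := he'.pos
  have hl := he.left (by omega)
  rw [Nat.add_sub_cancel] at hl
  have hm' := he'.marked
  have hY := Y.ev_le_succ
  have hv1 := hY (v - 1)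
  rw [Nat.sub_add_cancel hv] at hv1
  have hv2 := hY v
  have hvu' : v < u := by
    rcases Nat.lt_or_ge v u with h | h
    · exact h
    · obtain rfl : v = u := by omega
      omega
  refine ⟨hvu', ?_⟩
  obtain ⟨W, p, hp⟩ := exists_vAt A (j := v) (by omega) (by omega) (by
    rw [he.ev_eq _ (by omega), he.ev_eq _ (by omega), if_pos (by omega), if_pos (by omega), hm'])
  have hW := hp.dom
  have htp : ∀ k ≤ W.dom, tp (p ≫ e) k =
      if k < v then k else if k < u then k + 1 else k + 2 := by
    intro k hk
    rw [tp_comp, hp.tp_eq k hk, he.tp_eq _ (by split_ifs <;> omega)]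
    split_ifs <;> omega
  obtain ⟨p', hc, ht⟩ := he'.factor (p ≫ e) (by
    intro k hk
    rw [htp k hk]
    split_ifs <;> omega)
  refine ⟨W, p, p', hp, ⟨by omega, by omega, ?_, ?_, ?_, ?_⟩, hc.symm, ?_⟩
  · intro _
    rw [he'.ev_eq _ (by omega), he'.ev_eq _ (by omega), if_neg (by omega), if_neg (by omega),
      Nat.sub_add_cancel (by omega)]
    exact hl
  · intro _
    have hr := he.right (by omega)
    rw [he'.ev_eq _ (by omega), he'.ev_eq _ (by omega), if_neg (by omega), if_neg (by omega)]
    exact hr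
  · intro k hk
    rw [hp.ev_eq k hk, he.ev_eq k (by omega), he.ev_eq (k + 1) (by omega), he'.ev_eq k (by omega),
      he'.ev_eq (k + 1) (by omega)]
    split_ifs <;> first | rfl | omega
  · intro k hk
    rw [ht k hk, htp k hk]
    split_ifs <;> omega
  · intro X g g' hg
    obtain ⟨h, hh, -⟩ := hp.factor g (by
      intro k hk h1
      refine he'.avoid g' k ?_
      rw [← hg, tp_comp, he.tp_eq _ (tp_le _ _), h1, if_pos (by omega)])
    exact ⟨h, hh⟩

lemma exists_meet_ds_of_lt {a v : ℕ} {e : A ⟶ Y} {e' : B ⟶ Y} (he : DAt (a + 1) e)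
    (he' : SAt v e') (hva : v < a + 1) : ∃ (W : FatDelta) (p : W ⟶ A) (p' : W ⟶ B),
      SAt v p ∧ DAt a p' ∧ IsMeet p e p' e' := by
  have hA := he.dom
  have ha := he.lt
  have hB := he'.dom
  have hv := he'.le
  have hm := he.marked
  have hl := he'.left
  have hr := he'.right (by omega)
  have hr1 : ∀ k, v < k → Y.ev (v + 1) ≤ Y.ev k := fun k h => Y.ev_mono h
  obtain ⟨W, p, hp⟩ := exists_sAt A (v := v) (by omega) (by omega) (by
      intro h
      have := hl h
      rw [he.ev_eq _ (by omega), he.ev_eq _ (by omega)]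
      split_ifs <;> omega) (by
      intro h
      rw [he.ev_eq _ (by omega), he.ev_eq _ (by omega)]
      split_ifs <;> omega)
  have hW := hp.dom
  have htp : ∀ k ≤ W.dom, tp (p ≫ e) k = if k < v then k else k + 1 := by
    intro k hk
    rw [tp_comp, hp.tp_eq k hk, he.tp_eq _ (by split_ifs <;> omega)]
  obtain ⟨p', hc, ht⟩ := he'.factor (p ≫ e) (by
    intro k hk
    rw [htp k hk]
    split_ifs <;> omega)
  refine ⟨W, p, p', hp, ⟨by omega, by omega, ?_, ?_, ?_⟩, hc.symm, ?_⟩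
  · rw [he'.ev_eq _ (by omega), he'.ev_eq _ (by omega), if_neg (by omega), if_neg (by omega), hm]
  · intro k hk
    have := hr1 (k + 1)
    rw [hp.ev_eq k hk, he.ev_eq k (by omega), he.ev_eq (k + 1) (by omega), he'.ev_eq k (by omega)]
    split_ifs <;> first | rfl | omega
  · intro k hk
    rw [ht k hk, htp k hk]
    split_ifs <;> omega
  · intro X g g' hg
    obtain ⟨h, hh, -⟩ := hp.factor g (by
      intro k hk h1
      refine he'.avoid g' k ?_
      rw [← hg, tp_comp, he.tp_eq _ (tp_le _ _), h1])
    exact ⟨h, hh⟩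

lemma exists_meet_ds_of_gt {a v : ℕ} {e : A ⟶ Y} {e' : B ⟶ Y} (he : DAt a e)
    (he' : SAt v e') (hva : a + 1 < v) : ∃ (W : FatDelta) (p : W ⟶ A) (p' : W ⟶ B),
      SAt v p ∧ DAt a p' ∧ IsMeet p e p' e' := by
  have hA := he.dom
  have hB := he'.dom
  have hv := he'.le
  have hm := he.marked
  have hl := he'.left (by omega)
  have hr := he'.right
  have hr1 : ∀ k, v < k → Y.ev v ≤ Y.ev k := fun k h => Y.ev_mono h.le
  obtain ⟨W, p, hp⟩ := exists_sAt A (v := v) (by omega) (by omega) (by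
      intro h
      rw [he.ev_eq _ (by omega), he.ev_eq _ (by omega)]
      split_ifs <;> omega) (by
      intro h
      have := hr (by omega)
      rw [he.ev_eq _ (by omega), he.ev_eq _ (by omega)]
      split_ifs <;> omega)
  have hW := hp.dom
  have htp : ∀ k ≤ W.dom, tp (p ≫ e) k = if k < v then k else k + 1 := by
    intro k hk
    rw [tp_comp, hp.tp_eq k hk, he.tp_eq _ (by split_ifs <;> omega)]
  obtain ⟨p', hc, ht⟩ := he'.factor (p ≫ e) (by
    intro k hk
    rw [htp k hk]
    split_ifs <;> omega)
  refine ⟨W, p, p', hp, ⟨by omega, by omega, ?_, ?_, ?_⟩, hc.symm, ?_⟩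
  · rw [he'.ev_eq _ (by omega), he'.ev_eq _ (by omega), if_pos (by omega), if_pos (by omega), hm]
  · intro k hk
    have := hr1 (k + 1)
    rw [hp.ev_eq k hk, he.ev_eq k (by omega), he.ev_eq (k + 1) (by omega), he'.ev_eq k (by omega)]
    split_ifs <;> first | rfl | omega
  · intro k hk
    rw [ht k hk, htp k hk]
    split_ifs <;> omega
  · intro X g g' hg
    obtain ⟨h, hh, -⟩ := hp.factor g (by
      intro k hk h1
      refine he'.avoid g' k ?_
      rw [← hg, tp_comp, he.tp_eq _ (tp_le _ _), h1])
    exact ⟨h, hh⟩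

lemma exists_meet_dv_of_lt {a v : ℕ} {e : A ⟶ Y} {e' : B ⟶ Y} (he : DAt (a + 1) e)
    (he' : VAt v e') (hva : v < a + 1) : ∃ (W : FatDelta) (p : W ⟶ A) (p' : W ⟶ B),
      VAt v p ∧ DAt a p' ∧ IsMeet p e p' e' := by
  have hA := he.dom
  have ha := he.lt
  have hB := he'.dom
  have hp0 := he'.pos
  have hm := he.marked
  have hm' := he'.marked
  obtain ⟨W, p, hp⟩ := exists_vAt A (j := v) (by omega) (by omega) (by
      rw [he.ev_eq _ (by omega), he.ev_eq _ (by omega), if_pos (by omega), if_pos (by omega), hm'])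
  have hW := hp.dom
  have htp : ∀ k ≤ W.dom, tp (p ≫ e) k = if k < v then k else k + 1 := by
    intro k hk
    rw [tp_comp, hp.tp_eq k hk, he.tp_eq _ (by split_ifs <;> omega)]
  obtain ⟨p', hc, ht⟩ := he'.factor (p ≫ e) (by
    intro k hk
    rw [htp k hk]
    split_ifs <;> omega)
  refine ⟨W, p, p', hp, ⟨by omega, by omega, ?_, ?_, ?_⟩, hc.symm, ?_⟩
  · rw [he'.ev_eq _ (by omega), he'.ev_eq _ (by omega), if_neg (by omega), if_neg (by omega), hm]
  · intro k hk
    rw [hp.ev_eq k hk, he.ev_eq k (by omega), he.ev_eq (k + 1) (by omega), he'.ev_eq k (by omega)]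
    split_ifs <;> first | rfl | omega
  · intro k hk
    rw [ht k hk, htp k hk]
    split_ifs <;> omega
  · intro X g g' hg
    obtain ⟨h, hh, -⟩ := hp.factor g (by
      intro k hk h1
      refine he'.avoid g' k ?_
      rw [← hg, tp_comp, he.tp_eq _ (tp_le _ _), h1])
    exact ⟨h, hh⟩

lemma exists_meet_dv_of_gt {a v : ℕ} {e : A ⟶ Y} {e' : B ⟶ Y} (he : DAt a e)
    (he' : VAt v e') (hva : a + 1 < v) : ∃ (W : FatDelta) (p : W ⟶ A) (p' : W ⟶ B),
      VAt v p ∧ DAt a p' ∧ IsMeet p e p' e' := by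
  have hA := he.dom
  have hB := he'.dom
  have hp0 := he'.lt
  have hm := he.marked
  have hm' := he'.marked
  obtain ⟨W, p, hp⟩ := exists_vAt A (j := v) (by omega) (by omega) (by
      rw [he.ev_eq _ (by omega), he.ev_eq _ (by omega), if_neg (by omega), if_neg (by omega), hm'])
  have hW := hp.dom
  have htp : ∀ k ≤ W.dom, tp (p ≫ e) k = if k < v then k else k + 1 := by
    intro k hk
    rw [tp_comp, hp.tp_eq k hk, he.tp_eq _ (by split_ifs <;> omega)]
  obtain ⟨p', hc, ht⟩ := he'.factor (p ≫ e) (by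
    intro k hk
    rw [htp k hk]
    split_ifs <;> omega)
  refine ⟨W, p, p', hp, ⟨by omega, by omega, ?_, ?_, ?_⟩, hc.symm, ?_⟩
  · rw [he'.ev_eq _ (by omega), he'.ev_eq _ (by omega), if_pos (by omega), if_pos (by omega), hm]
  · intro k hk
    rw [hp.ev_eq k hk, he.ev_eq k (by omega), he.ev_eq (k + 1) (by omega), he'.ev_eq k (by omega)]
    split_ifs <;> first | rfl | omega
  · intro k hk
    rw [ht k hk, htp k hk]
    split_ifs <;> omega
  · intro X g g' hg
    obtain ⟨h, hh, -⟩ := hp.factor g (by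
      intro k hk h1
      refine he'.avoid g' k ?_
      rw [← hg, tp_comp, he.tp_eq _ (tp_le _ _), h1])
    exact ⟨h, hh⟩

/-- Unmarking an edge next to an inner marked vertex and removing that vertex: the meet is obtained
from the two ends of the edge by unmarking both of its halves and removing a standard vertex. -/
lemma exists_meet_dv_of_adjacent {a w : ℕ} {e : A ⟶ Y} {e' : B ⟶ Y} (he : DAt a e)
    (he' : VAt (w + 1) e') (haw : a = w ∨ a = w + 1) :
    ∃ (W Z : FatDelta) (s : W ⟶ Z) (d : Z ⟶ A) (p' : W ⟶ B),
      SAt (w + 1) s ∧ DAt (2 * w + 1 - a) d ∧ DAt w p' ∧ IsMeet (s ≫ d) e p' e' := by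
  have hA := he.dom
  have ha := he.lt
  have hB := he'.dom
  have hv := he'.lt
  have hm := he.marked
  have hm' := he'.marked
  rw [Nat.add_sub_cancel] at hm'
  have hY1 := Y.ev_le_succ w
  have hY2 := Y.ev_le_succ (w + 1)
  have hw1 := he.ev_eq w (by omega)
  have hw2 := he.ev_eq (w + 1) (by omega)
  have hw3 := he.ev_eq (w + 1 + 1) (by omega)
  -- `2 * w + 1 - a` is the other one of the two edges at `w + 1`; with both unmarked, `w + 1` is
  -- standard.
  obtain ⟨Z, d, hd⟩ := exists_dAt A (a := 2 * w + 1 - a) (by omega) (by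
    rcases haw with rfl | rfl
    · rw [show 2 * a + 1 - a = a + 1 by omega]
      split_ifs at hw2 hw3 <;> omega
    · rw [show 2 * w + 1 - (w + 1) = w by omega]
      split_ifs at hw1 hw2 <;> omega)
  have hZ := hd.dom
  have hZY : ∀ k ≤ Z.dom, Z.ev k = if k ≤ w then Y.ev k else
      if k ≤ w + 1 then Y.ev k + 1 else Y.ev k + 2 := by
    intro k hk
    rw [hd.ev_eq k hk, he.ev_eq k (by omega)]
    rcases haw with rfl | rfl <;> split_ifs <;> omega
  obtain ⟨W, s, hs⟩ := exists_sAt Z (v := w + 1) (by omega) (by omega) (by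
      intro _
      rw [Nat.add_sub_cancel, hZY _ (by omega), hZY _ (by omega)]
      split_ifs <;> omega) (by
      intro _
      rw [hZY _ (by omega), hZY _ (by omega)]
      split_ifs <;> omega)
  have hW := hs.dom
  have hWY : ∀ k ≤ W.dom, W.ev k = if k ≤ w then Y.ev k else Y.ev (k + 1) + 1 := by
    intro k hk
    rw [hs.ev_eq k hk, hZY k (by omega), hZY (k + 1) (by omega)]
    split_ifs <;> omega
  have htp : ∀ k ≤ W.dom, tp ((s ≫ d) ≫ e) k = if k < w + 1 then k else k + 1 := by
    intro k hk
    have h1 : (if k < w + 1 then k else k + 1) ≤ Z.dom := by split_ifs <;> omega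
    rw [tp_comp, tp_comp, hs.tp_eq k hk, hd.tp_eq _ h1, he.tp_eq _ (by omega)]
  obtain ⟨p', hc, ht⟩ := he'.factor ((s ≫ d) ≫ e) (by
    intro k hk
    rw [htp k hk]
    split_ifs <;> omega)
  refine ⟨W, Z, s, d, p', hs, hd, ⟨by omega, by omega, ?_, ?_, ?_⟩, hc.symm, ?_⟩
  · rw [he'.ev_eq _ (by omega), he'.ev_eq _ (by omega), if_pos (by omega), if_neg (by omega), hm']
  · intro k hk
    rw [hWY k hk, he'.ev_eq k (by omega)]
    split_ifs <;> omega
  · intro k hk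
    rw [ht k hk, htp k hk]
    split_ifs <;> omega
  · intro X g g' hg
    have hne : ∀ k, tp g k ≠ w + 1 := by
      intro k h1
      refine he'.avoid g' k ?_
      rw [← hg, tp_comp, he.tp_eq _ (tp_le _ _), h1]
    -- Since `g` misses `w + 1`, an edge sent across one of the two edges at `w + 1` is sent across
    -- both, so avoiding the cut at `a` suffices.
    obtain ⟨h, hh, hth⟩ := hd.factor g (by
      intro k hk h1 h2
      have h3 := he.avoid g h1
      rw [tp_comp, tp_comp, he.tp_eq _ (tp_le _ _), he.tp_eq _ (tp_le _ _)] at h3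
      have h4 := hne k
      have h5 := hne (k + 1)
      have h6 := tp_lt_succ g hk
      omega)
    obtain ⟨h', hh', -⟩ := hs.factor h (by
      intro k hk
      rw [hth k hk]
      exact hne k)
    exact ⟨h', by rw [← Category.assoc, hh', hh]⟩

end FatDelta

/-! ### Formal composites and existence of the factorisation. -/

namespace FatDelta

variable {X Y Z A B : FatDelta}

/-- The formal composite consisting of one face. -/
def arrow (e : Face X Y) : FacePath X Y := (Paths.of FaceQuiver).map e

lemma composite_arrow (e : Face X Y) : composite.map (arrow e) = e.1 :=
  Category.id_comp (e.1 : X ⟶ Y)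

/-- The empty formal composite. -/
def idPath (X : FatDelta) : FacePath X X := @CategoryStruct.id FacePaths _ X

/-- Concatenation of formal composites. -/
def compPath (p : FacePath X Y) (q : FacePath Y Z) : FacePath X Z := p ≫ q

/-- The composite of a formal composite. -/
def eval (p : FacePath X Y) : X ⟶ Y := composite.map p

lemma eval_arrow (e : Face X Y) : eval (arrow e) = e.1 := composite_arrow e

lemma eval_id : eval (idPath X) = 𝟙 X := rfl

lemma eval_comp (p : FacePath X Y) (q : FacePath Y Z) :
    eval (compPath p q) = eval p ≫ eval q := composite.map_comp p q

lemma compPath_assoc {W : FatDelta} (p : FacePath W X) (q : FacePath X Y) (r : FacePath Y Z) :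
    compPath (compPath p q) r = compPath p (compPath q r) := Category.assoc p q r

/-- The face given by a morphism that marks an edge. -/
def DAt.face {a : ℕ} {f : X ⟶ Y} (h : DAt a f) : Face X Y :=
  ⟨f, Or.inl ⟨_, isDegeneratedFace_iff.2 ⟨a, h, rfl⟩⟩⟩

/-- The face given by a morphism that inserts an inner marked vertex. -/
def VAt.face {j : ℕ} {f : X ⟶ Y} (h : VAt j f) : Face X Y :=
  ⟨f, Or.inr (Or.inl ⟨_, isVerticalFace_iff.2 h⟩)⟩

/-- The face given by a morphism that inserts a standard vertex. -/
def SAt.face {v : ℕ} {f : X ⟶ Y} (h : SAt v f) : Face X Y :=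
  ⟨f, Or.inr (Or.inr ⟨_, isStandardFace_iff.2 ⟨v, h, rfl⟩⟩)⟩

lemma isD_arrow {a i : ℕ} {e : Face X Y} (h : DAt a e.1) (hi : Y.ev a = i) : IsD i (arrow e) :=
  ⟨e, isDegeneratedFace_iff.2 ⟨a, h, hi⟩, rfl⟩

lemma isV_arrow {j : ℕ} {e : Face X Y} (h : VAt j e.1) : IsV j (arrow e) :=
  ⟨e, isVerticalFace_iff.2 h, rfl⟩

lemma isS_arrow {v i : ℕ} {e : Face X Y} (h : SAt v e.1) (hi : Y.ev v = i) : IsS i (arrow e) :=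
  ⟨e, isStandardFace_iff.2 ⟨v, h, hi⟩, rfl⟩

lemma IsChain.snoc {ι : Type} {P : ι → ∀ {X Y : FacePaths}, (X ⟶ Y) → Prop} {l : List ι}
    {X Y Z : FacePaths} {p : X ⟶ Y} {q : Y ⟶ Z} {a : ι} (hp : IsChain P l p) (hq : P a q) :
    IsChain P (l ++ [a]) (p ≫ q) := by
  induction hp with
  | nil X =>
    have := IsChain.cons hq (IsChain.nil Z)
    rw [Category.comp_id] at this
    rw [Category.id_comp]
    exact this
  | cons h _ ih =>
    rw [Category.assoc]
    exact IsChain.cons h (ih hq)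

lemma pairwise_snoc {ι : Type} {R : ι → ι → Prop} {l : List ι} {a : ι} (h : l.Pairwise R)
    (ha : ∀ x ∈ l, R x a) : (l ++ [a]).Pairwise R := by
  rw [List.pairwise_append]
  exact ⟨h, List.pairwise_singleton R a, fun x hx y hy => List.mem_singleton.1 hy ▸ ha x hx⟩

lemma mem_snoc {ι : Type} {Q : ι → Prop} {l : List ι} {a : ι} (h : ∀ x ∈ l, Q x) (ha : Q a) :
    ∀ x ∈ l ++ [a], Q x := by
  intro x hx
  rcases List.mem_append.1 hx with h1 | h1
  · exact h x h1
  · exact List.mem_singleton.1 h1 ▸ ha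

/-- The vertex `v` of the target is not a value of `f`. -/
def Misses (f : X ⟶ Y) (v : ℕ) : Prop := ∀ k ≤ X.dom, tp f k ≠ v

/-- Deleting `v` renumbers the later vertices down by one; this undoes the renumbering. -/
lemma Misses.of_skip {v w : ℕ} {f : X ⟶ Y} {g : X ⟶ Z}
    (hg : ∀ k ≤ X.dom, tp g k = if tp f k < v then tp f k else tp f k - 1) (hw : Misses g w) :
    Misses f (if w < v then w else w + 1) := by
  intro k hk h1
  refine hw k hk ?_
  rw [hg k hk, h1]
  split_ifs <;> omega

lemma not_misses {f : X ⟶ Y} {v : ℕ} (h : ¬ Misses f v) : ∃ k ≤ X.dom, tp f k = v := by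
  unfold Misses at h
  push Not at h
  exact h

/-- The vertex `j` has a predecessor and a successor in its fibre. -/
def Inner (Y : FatDelta) (j : ℕ) : Prop := 0 < j ∧ j < Y.dom ∧ Y.ev (j - 1) = Y.ev (j + 1)

/-- The greatest missed inner vertex is deleted by the last face. Those that remain lie strictly
below it and keep their numbers, so the indices increase strictly. -/
lemma exists_increasingV (N : ℕ) : ∀ {Y : FatDelta} (f : X ⟶ Y),
    (∀ j, Inner Y j → Misses f j → j < N) →
    ∃ (C : FatDelta) (τ : FacePath C Y) (g : X ⟶ C) (l : List ℕ), l.Pairwise (· < ·) ∧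
      (∀ x ∈ l, x < N) ∧ IsChain (fun i => IsV i) l τ ∧ g ≫ eval τ = f ∧
      ∀ j, Inner C j → ¬ Misses g j := by
  induction N with
  | zero =>
    intro Y f h
    exact ⟨Y, idPath Y, f, [], List.Pairwise.nil, by simp, IsChain.nil _,
      Category.comp_id f, fun j h1 h2 => Nat.not_lt_zero _ (h j h1 h2)⟩
  | succ N ih =>
    intro Y f h
    by_cases hN : Inner Y N ∧ Misses f N
    · obtain ⟨⟨h1, h2, h3⟩, h4⟩ := hN
      obtain ⟨A, e, he⟩ := exists_vAt Y h1 h2 h3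
      have hd := he.dom
      obtain ⟨g, hg, htg⟩ := he.factor f h4
      obtain ⟨C, τ, g', l, hl, hlN, hτ, hg', hC⟩ := ih g (by
        rintro j ⟨hj1, hj2, hj3⟩ hj4
        by_contra hj5
        have h5 := Misses.of_skip htg hj4
        rw [if_neg hj5] at h5
        refine hj5 (Nat.lt_of_succ_lt_succ (h (j + 1) ⟨by omega, by omega, ?_⟩ h5))
        rw [he.ev_eq _ (by omega), he.ev_eq _ (by omega), if_neg (show ¬ j + 1 < N by omega)] at hj3
        rw [Nat.add_sub_cancel]
        have h6 := Y.ev_le_succ j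
        have h7 := Y.ev_le_succ (j + 1)
        split_ifs at hj3
        · obtain rfl : j = N := by omega
          have h8 := Y.ev_mono (Nat.sub_le j 1)
          omega
        · rwa [Nat.sub_add_cancel hj1] at hj3)
      refine ⟨C, compPath τ (arrow he.face), g', l ++ [N], pairwise_snoc hl hlN,
        mem_snoc (fun x hx => (hlN x hx).trans (Nat.lt_succ_self N)) (Nat.lt_succ_self N),
        hτ.snoc (isV_arrow he), ?_, hC⟩
      rw [eval_comp, eval_arrow, ← Category.assoc, hg']
      exact hg
    · obtain ⟨C, τ, g', l, hl, hlN, hτ, hg', hC⟩ := ih f (fun j h1 h2 =>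
        lt_of_le_of_ne (Nat.le_of_lt_succ (h j h1 h2)) (by rintro rfl; exact hN ⟨h1, h2⟩))
      exact ⟨C, τ, g', l, hl, fun x hx => (hlN x hx).trans (Nat.lt_succ_self N), hτ, hg', hC⟩

/-- A bordering extension through which a morphism that misses an end of a fibre factors. -/
lemma exists_border {f : X ⟶ Y} {v : ℕ} {ε : Fin 2} (hv : Misses f v)
    (h : (ε = 0 ∧ v < Y.dom ∧ Y.ev v = Y.ev (v + 1) ∧ (0 < v → Y.ev (v - 1) < Y.ev v)) ∨
      (ε = 1 ∧ 0 < v ∧ v ≤ Y.dom ∧ Y.ev (v - 1) = Y.ev v ∧ (v < Y.dom → Y.ev v < Y.ev (v + 1)))) :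
    ∃ (W : FatDelta) (r : FacePath W Y) (g : X ⟶ W), IsB (Y.ev v) ε r ∧
      g ≫ eval r = f ∧ Y.dom = W.dom + 1 ∧
      (∀ k ≤ W.dom, W.ev k = if k < v then Y.ev k else Y.ev (k + 1)) ∧
      ∀ k ≤ X.dom, tp g k = if tp f k < v then tp f k else tp f k - 1 := by
  -- The edge `a` joins `v` to the rest of its fibre, so unmarking it makes `v` standard. As `v` is
  -- missed, an edge sent across `a` passes beyond `v` on the side where another fibre begins, and
  -- is therefore not marked.
  suffices H : ∃ (W Z : FatDelta) (s : W ⟶ Z) (d : Z ⟶ Y) (a : ℕ), SAt v s ∧ DAt a d ∧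
      Z.ev v = Y.ev v + ε ∧ Y.ev a = Y.ev v ∧
      (∀ k ≤ Z.dom, (k < v → Z.ev k = Y.ev k) ∧ (v < k → Z.ev k = Y.ev k + 1)) ∧
      (∀ k < X.dom, X.ev k = X.ev (k + 1) → tp f k ≤ a → tp f (k + 1) ≤ a) by
    obtain ⟨W, Z, s, d, a, hs, hd, h1, h2, h3, h4⟩ := H
    have hdd := hd.dom
    have hsd := hs.dom
    obtain ⟨g, hg, htg⟩ := hd.factor f h4
    obtain ⟨g', hg', htg'⟩ := hs.factor g (fun k hk => by rw [htg k hk]; exact hv k hk)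
    refine ⟨W, compPath (arrow hs.face) (arrow hd.face), g', ⟨Z, arrow hs.face, arrow hd.face,
      isS_arrow hs h1, isD_arrow hd h2, rfl⟩, ?_, by omega, ?_, ?_⟩
    · rw [eval_comp, eval_arrow, eval_arrow, ← Category.assoc]
      exact (congrArg (· ≫ d) hg').trans hg
    · intro k hk
      rw [hs.ev_eq k hk]
      split_ifs with h5
      · exact (h3 k (by omega)).1 h5
      · rw [(h3 (k + 1) (by omega)).2 (by omega), Nat.add_sub_cancel]
    · intro k hk
      rw [htg' k hk, htg k hk]
  rcases h with ⟨rfl, h1, h2, h3⟩ | ⟨rfl, h0, h1, h2, h3⟩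
  · obtain ⟨Z, d, hd⟩ := exists_dAt Y h1 h2
    have hdd := hd.dom
    have hZv := hd.ev_eq v (by omega)
    rw [if_pos le_rfl] at hZv
    obtain ⟨W, s, hs⟩ := exists_sAt Z (v := v) (by omega) (by omega) (by
        intro h
        have := h3 h
        rw [hZv, hd.ev_eq _ (by omega), if_pos (by omega)]
        exact this) (by
        intro h
        rw [hZv, hd.ev_eq _ (by omega), if_neg (by omega)]
        omega)
    refine ⟨W, Z, s, d, v, hs, hd, hZv, rfl, ?_, ?_⟩
    · intro k hk
      rw [hd.ev_eq k hk]
      constructor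
      · intro h5
        rw [if_pos h5.le]
      · intro h5
        rw [if_neg (not_le.2 h5)]
    · intro k hk hX h4
      by_contra h5
      have h6 := hv k hk.le
      have h7 := h3 (by omega)
      have h8 : Y.ev (tp f k) ≤ Y.ev (v - 1) := Y.ev_mono (by omega)
      have h9 : Y.ev v ≤ Y.ev (tp f (k + 1)) := Y.ev_mono (by omega)
      have := ev_tp_eq f hX
      omega
  · obtain ⟨Z, d, hd⟩ := exists_dAt Y (a := v - 1) (by omega) (by
      rw [Nat.sub_add_cancel h0, h2])
    have hdd := hd.dom
    have hZv := hd.ev_eq v (by omega)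
    rw [if_neg (by omega)] at hZv
    obtain ⟨W, s, hs⟩ := exists_sAt Z (v := v) (by omega) (by omega) (by
        intro _
        rw [hZv, hd.ev_eq _ (by omega), if_pos le_rfl]
        omega) (by
        intro h
        have := h3 (by omega)
        rw [hZv, hd.ev_eq _ (by omega), if_neg (by omega)]
        omega)
    refine ⟨W, Z, s, d, v - 1, hs, hd, hZv, h2, ?_, ?_⟩
    · intro k hk
      rw [hd.ev_eq k (by omega)]
      constructor
      · intro h5
        rw [if_pos (by omega)]
      · intro h5
        rw [if_neg (by omega)]
    · intro k hk hX h4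
      by_contra h5
      have h6 := hv (k + 1) hk
      have h8 : Y.ev (tp f k) ≤ Y.ev (v - 1) := Y.ev_mono h4
      have h10 := tp_le f (k + 1)
      have h7 := h3 (by omega)
      have h9 : Y.ev (v + 1) ≤ Y.ev (tp f (k + 1)) := Y.ev_mono (by omega)
      have := ev_tp_eq f hX
      omega

/-- The code `2 * c + ε` turns the lexicographic order on pairs into the order of natural numbers;
the missed fibre end of greatest code is removed by the last bordering extension. Without missed
inner vertices, each end of a fibre can be removed at most once, so codes decrease strictly. -/
lemma exists_increasingB (N : ℕ) : ∀ {Y : FatDelta} (f : X ⟶ Y),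
    (∀ j, Inner Y j → ¬ Misses f j) →
    (∀ v ≤ Y.dom, Misses f v → (v < Y.dom → Y.ev v = Y.ev (v + 1) → 2 * Y.ev v < N) ∧
      (0 < v → Y.ev (v - 1) = Y.ev v → 2 * Y.ev v + 1 < N)) →
    ∃ (C : FatDelta) (τ : FacePath C Y) (g : X ⟶ C) (l : List (ℕ × Fin 2)),
      l.Pairwise (Prod.Lex (· < ·) (· < ·)) ∧ (∀ x ∈ l, 2 * x.1 + x.2.val < N) ∧
      IsChain (fun c => IsB c.1 c.2) l τ ∧ g ≫ eval τ = f ∧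
      ∀ v ≤ C.dom, Misses g v →
        (v < C.dom → C.ev v < C.ev (v + 1)) ∧ (0 < v → C.ev (v - 1) < C.ev v) := by
  induction N with
  | zero =>
    intro Y f _ h
    refine ⟨Y, idPath Y, f, [], List.Pairwise.nil, by simp, IsChain.nil _,
      Category.comp_id f, fun v h1 h2 => ⟨fun h3 => ?_, fun h3 => ?_⟩⟩
    · exact lt_of_le_of_ne (Y.ev_le_succ v) fun h4 => Nat.not_lt_zero _ ((h v h1 h2).1 h3 h4)
    · exact lt_of_le_of_ne (Y.ev_mono (Nat.sub_le v 1)) fun h4 =>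
        Nat.not_lt_zero _ ((h v h1 h2).2 h3 h4)
  | succ N ih =>
    intro Y f hin h
    by_cases hN : ∃ v ≤ Y.dom, Misses f v ∧ ∃ ε : Fin 2, 2 * Y.ev v + ε.val = N ∧
      ((ε = 0 ∧ v < Y.dom ∧ Y.ev v = Y.ev (v + 1)) ∨
        (ε = 1 ∧ 0 < v ∧ Y.ev (v - 1) = Y.ev v))
    · obtain ⟨v, hv, hvf, ε, hε, hcase⟩ := hN
      have hvin : ¬ Inner Y v := fun h1 => hin v h1 hvf
      have hY := Y.ev_le_succ
      have hY0 : Y.ev (v - 1) ≤ Y.ev v := Y.ev_mono (Nat.sub_le v 1)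
      have hY1 := hY v
      have hcase' : (ε = 0 ∧ v < Y.dom ∧ Y.ev v = Y.ev (v + 1) ∧
            (0 < v → Y.ev (v - 1) < Y.ev v)) ∨
          (ε = 1 ∧ 0 < v ∧ v ≤ Y.dom ∧ Y.ev (v - 1) = Y.ev v ∧
            (v < Y.dom → Y.ev v < Y.ev (v + 1))) := by
        rcases hcase with ⟨h0, h1, h2⟩ | ⟨h0, h1, h2⟩
        · refine Or.inl ⟨h0, h1, h2, fun h3 => lt_of_le_of_ne hY0 fun h4 => ?_⟩
          exact hvin ⟨h3, h1, h4.trans h2⟩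
        · refine Or.inr ⟨h0, h1, hv, h2, fun h3 => lt_of_le_of_ne hY1 fun h4 => ?_⟩
          exact hvin ⟨h1, h3, h2.trans h4⟩
      -- The neighbours of a fibre end lie in different fibres, so its removal creates no new marked
      -- edge.
      have hdiff : 0 < v → v < Y.dom → Y.ev (v - 1) < Y.ev (v + 1) := by
        intro h1 h2
        rcases hcase' with ⟨-, h3, h4, h5⟩ | ⟨-, h3, h4, h5, h6⟩
        · exact lt_of_lt_of_le (h5 h1) hY1
        · exact lt_of_le_of_lt hY0 (h6 h2)
      obtain ⟨W, r, g, hr, hg, hd, hWev, htg⟩ := exists_border hvf hcase'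
      have hWlo : ∀ k ≤ W.dom, k < v → W.ev k = Y.ev k := fun k hk h1 => by
        rw [hWev k hk, if_pos h1]
      have hWhi : ∀ k ≤ W.dom, v ≤ k → W.ev k = Y.ev (k + 1) := fun k hk h1 => by
        rw [hWev k hk, if_neg (not_lt.2 h1)]
      have hlo : ∀ w, Misses g w → w < v → Misses f w := fun w hw h1 => by
        have := Misses.of_skip htg hw
        rwa [if_pos h1] at this
      have hhi : ∀ w, Misses g w → v ≤ w → Misses f (w + 1) := fun w hw h1 => by
        have := Misses.of_skip htg hw
        rwa [if_neg (not_lt.2 h1)] at this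
      obtain ⟨C, τ, g', l, hl, hlN, hτ, hg', hC⟩ := ih g (by
        rintro j ⟨hj1, hj2, hj3⟩ hj4
        rcases Nat.lt_or_ge j v with h1 | h1
        · rw [hWlo _ (by omega) (by omega)] at hj3
          rcases Nat.lt_or_ge (j + 1) v with h2 | h2
          · rw [hWlo _ (by omega) h2] at hj3
            exact hin j ⟨hj1, by omega, hj3⟩ (hlo j hj4 h1)
          · obtain rfl : j + 1 = v := by omega
            rw [hWhi _ (by omega) h2] at hj3
            have h3 := hdiff (by omega) (by omega)
            have h4 := Y.ev_mono (Nat.sub_le j 1)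
            rw [Nat.add_sub_cancel] at h3
            omega
        · rw [hWhi _ (by omega) (show v ≤ j + 1 by omega)] at hj3
          rcases Nat.lt_or_ge (j - 1) v with h2 | h2
          · obtain rfl : j = v := by omega
            rw [hWlo _ (by omega) h2] at hj3
            have h3 := hdiff (by omega) (by omega)
            have h4 := hY (j + 1)
            omega
          · rw [hWhi _ (by omega) h2, Nat.sub_add_cancel hj1] at hj3
            exact hin (j + 1) ⟨by omega, by omega, hj3⟩ (hhi j hj4 h1)) (by
        intro w hw hwg
        constructor
        · intro h1 h2
          rcases Nat.lt_or_ge w v with h3 | h3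
          · rw [hWlo w hw h3] at h2 ⊢
            rcases Nat.lt_or_ge (w + 1) v with h4 | h4
            · rw [hWlo _ (by omega) h4] at h2
              have h5 := (h w (by omega) (hlo w hwg h3)).1 (by omega) h2
              rcases hcase' with ⟨rfl, -, -, h6⟩ | ⟨rfl, -⟩
              · have h7 := h6 (by omega)
                have h8 : Y.ev w ≤ Y.ev (v - 1) := Y.ev_mono (by omega)
                simp only [Fin.val_zero] at hε
                omega
              · simp only [Fin.val_one] at hε
                omega
            · obtain rfl : w + 1 = v := by omega
              rw [hWhi _ (by omega) h4] at h2
              have h5 := hdiff (by omega) (by omega)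
              rw [Nat.add_sub_cancel] at h5
              omega
          · rw [hWhi w hw h3] at h2 ⊢
            rw [hWhi _ (by omega) (by omega)] at h2
            have h5 := (h (w + 1) (by omega) (hhi w hwg h3)).1 (by omega) h2
            have h6 : Y.ev (v + 1) ≤ Y.ev (w + 1) := Y.ev_mono (by omega)
            -- For `ε = 0`, a missed vertex that could play the same role again was an inner vertex
            -- of `Y`; for `ε = 1`, the vertex lies in a later fibre and its code would be too
            -- large.
            rcases hcase' with ⟨rfl, h7, h8, -⟩ | ⟨rfl, -, -, -, h7⟩
            · exfalso
              simp only [Fin.val_zero] at hε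
              have h9 : Y.ev v ≤ Y.ev w := Y.ev_mono h3
              have h10 := hY w
              exact hin (w + 1) ⟨by omega, by omega, by
                rw [Nat.add_sub_cancel]
                omega⟩ (hhi w hwg h3)
            · have h8 := h7 (by omega)
              simp only [Fin.val_one] at hε
              omega
        · intro h1 h2
          rcases Nat.lt_or_ge w v with h3 | h3
          · rw [hWlo w hw h3] at h2 ⊢
            rw [hWlo _ (by omega) (by omega)] at h2
            have h5 := (h w (by omega) (hlo w hwg h3)).2 h1 h2
            rcases hcase' with ⟨rfl, -, -, h6⟩ | ⟨rfl, h0, h6, h7, h8⟩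
            · simp only [Fin.val_zero] at hε
              omega
            · simp only [Fin.val_one] at hε
              by_contra h9
              have h10 : Y.ev w ≤ Y.ev (v - 1) := Y.ev_mono (by omega)
              have h11 : Y.ev (w + 1) ≤ Y.ev v := Y.ev_mono h3
              have h12 := hY w
              exact hin w ⟨h1, by omega, by omega⟩ (hlo w hwg h3)
          · rw [hWhi w hw h3] at h2 ⊢
            rcases Nat.lt_or_ge (w - 1) v with h4 | h4
            · obtain rfl : w = v := by omega
              rw [hWlo _ (by omega) h4] at h2
              have h5 := hdiff h1 (by omega)
              omega
            · rw [hWhi _ (by omega) h4, Nat.sub_add_cancel h1] at h2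
              have h5 := (h (w + 1) (by omega) (hhi w hwg h3)).2 (by omega) (by
                rw [Nat.add_sub_cancel]
                exact h2)
              have h6 : Y.ev (v + 1) ≤ Y.ev (w + 1) := Y.ev_mono (by omega)
              rcases hcase' with ⟨rfl, h7, h8, -⟩ | ⟨rfl, -, -, -, h7⟩
              · simp only [Fin.val_zero] at hε
                omega
              · have h8 := h7 (by omega)
                simp only [Fin.val_one] at hε
                omega)
      refine ⟨C, compPath τ r, g', l ++ [(Y.ev v, ε)], pairwise_snoc hl ?_,
        mem_snoc (fun x hx => (hlN x hx).trans (Nat.lt_succ_self N)) ?_, hτ.snoc hr, ?_, hC⟩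
      · intro x hx
        have h1 := hlN x hx
        have h2 := x.2.isLt
        have h3 := ε.isLt
        rw [Prod.lex_def]
        rcases Nat.lt_or_ge x.1 (Y.ev v) with h4 | h4
        · exact Or.inl h4
        · exact Or.inr ⟨by dsimp only; omega, Fin.lt_def.2 (by dsimp only; omega)⟩
      · dsimp only
        omega
      · rw [eval_comp, ← Category.assoc, hg', hg]
    · obtain ⟨C, τ, g', l, hl, hlN, hτ, hg', hC⟩ := ih f hin (fun v hv hvf =>
        ⟨fun h1 h2 => lt_of_le_of_ne (Nat.le_of_lt_succ ((h v hv hvf).1 h1 h2)) fun h3 =>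
            hN ⟨v, hv, hvf, 0, h3, Or.inl ⟨rfl, h1, h2⟩⟩,
          fun h1 h2 => lt_of_le_of_ne (Nat.le_of_lt_succ ((h v hv hvf).2 h1 h2)) fun h3 =>
            hN ⟨v, hv, hvf, 1, h3, Or.inr ⟨rfl, h1, h2⟩⟩⟩)
      exact ⟨C, τ, g', l, hl, fun x hx => (hlN x hx).trans (Nat.lt_succ_self N), hτ, hg', hC⟩

/-- All missed vertices are standard here, so their indices are distinct; deleting the one of
greatest index leaves the others standard with unchanged indices. -/
lemma exists_increasingS (N : ℕ) : ∀ {Y : FatDelta} (f : X ⟶ Y),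
    (∀ v ≤ Y.dom, Misses f v →
      (v < Y.dom → Y.ev v < Y.ev (v + 1)) ∧ (0 < v → Y.ev (v - 1) < Y.ev v) ∧ Y.ev v < N) →
    ∃ (C : FatDelta) (τ : FacePath C Y) (g : X ⟶ C) (l : List ℕ), l.Pairwise (· < ·) ∧
      (∀ x ∈ l, x < N) ∧ IsChain (fun i => IsS i) l τ ∧ g ≫ eval τ = f ∧
      ∀ v ≤ C.dom, ¬ Misses g v := by
  induction N with
  | zero =>
    intro Y f h
    exact ⟨Y, idPath Y, f, [], List.Pairwise.nil, by simp, IsChain.nil _,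
      Category.comp_id f, fun v h1 h2 => Nat.not_lt_zero _ (h v h1 h2).2.2⟩
  | succ N ih =>
    intro Y f h
    by_cases hN : ∃ v ≤ Y.dom, Misses f v ∧ Y.ev v = N
    · obtain ⟨v, hv, hvf, rfl⟩ := hN
      obtain ⟨hr, hl, -⟩ := h v hv hvf
      -- The value of `f` at 0 differs from `v`, so `Y` has a second vertex.
      have h0 := hvf 0 (Nat.zero_le _)
      have h1 := tp_le f 0
      obtain ⟨A, e, he⟩ := exists_sAt Y (by omega) hv hl hr
      have hd := he.dom
      obtain ⟨g, hg, htg⟩ := he.factor f hvf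
      obtain ⟨C, τ, g', l, hl, hlN, hτ, hg', hC⟩ := ih g (by
        intro w hw hwg
        have hwf := Misses.of_skip htg hwg
        rcases Nat.lt_or_ge w v with h2 | h2
        · rw [if_pos h2] at hwf
          obtain ⟨h3, h4, h5⟩ := h w (by omega) hwf
          have h6 := hl (by omega)
          have h7 : Y.ev w ≤ Y.ev (v - 1) := Y.ev_mono (by omega)
          rw [he.ev_eq w hw, if_pos h2]
          refine ⟨fun h8 => ?_, fun h8 => ?_, by omega⟩
          · have h9 := h3 (by omega)
            rw [he.ev_eq _ (by omega)]
            split_ifs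
            · exact h9
            · obtain rfl : w + 1 = v := by omega
              have := hr (by omega)
              omega
          · rw [he.ev_eq _ (by omega), if_pos (by omega)]
            exact h4 h8
        · rw [if_neg (not_lt.2 h2)] at hwf
          obtain ⟨h3, h4, h5⟩ := h (w + 1) (by omega) hwf
          have h6 := hr (by omega)
          have h7 : Y.ev (v + 1) ≤ Y.ev (w + 1) := Y.ev_mono (by omega)
          omega)
      refine ⟨C, compPath τ (arrow he.face), g', l ++ [Y.ev v], pairwise_snoc hl hlN,
        mem_snoc (fun x hx => (hlN x hx).trans (Nat.lt_succ_self _)) (Nat.lt_succ_self _),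
        hτ.snoc (isS_arrow he rfl), ?_, hC⟩
      rw [eval_comp, eval_arrow, ← Category.assoc, hg']
      exact hg
    · obtain ⟨C, τ, g', l, hl, hlN, hτ, hg', hC⟩ := ih f (fun v hv hvf => by
        obtain ⟨h1, h2, h3⟩ := h v hv hvf
        exact ⟨h1, h2, lt_of_le_of_ne (Nat.le_of_lt_succ h3) fun h4 => hN ⟨v, hv, hvf, h4⟩⟩)
      exact ⟨C, τ, g', l, hl, fun x hx => (hlN x hx).trans (Nat.lt_succ_self N), hτ, hg', hC⟩

lemma tp_eq_self {f : X ⟶ Y} (h : ∀ v ≤ Y.dom, ¬ Misses f v) :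
    Y.dom = X.dom ∧ ∀ k ≤ X.dom, tp f k = k := by
  have key : ∀ k ≤ X.dom, tp f k = k := by
    intro k
    induction k with
    | zero =>
      intro _
      obtain ⟨l, _, hl⟩ := not_misses (h 0 (Nat.zero_le _))
      have := tp_mono f (Nat.zero_le l)
      omega
    | succ k ih =>
      intro hk
      have h1 := ih (by omega)
      have h2 := tp_lt_succ f hk
      have h3 := tp_le f (k + 1)
      obtain ⟨l, _, hl⟩ := not_misses (h (k + 1) (by omega))
      rcases Nat.lt_or_ge k l with h4 | h4
      · have : tp f (k + 1) ≤ tp f l := tp_mono f h4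
        omega
      · have := tp_mono f h4
        omega
  refine ⟨?_, key⟩
  obtain ⟨l, hl, h1⟩ := not_misses (h Y.dom le_rfl)
  have h2 := key l hl
  have h3 := key X.dom le_rfl
  have h4 := tp_le f X.dom
  omega

/-- The rightmost edge marked in `Y` but not in `X` is unmarked by the last face. `N` bounds
positions and drives the induction, `K` bounds indices; several such edges may lie in one fibre, so
the indices increase only weakly. -/
lemma exists_increasingD (N K : ℕ) : ∀ {Y : FatDelta} (f : X ⟶ Y), Y.dom = X.dom →
    (∀ k ≤ X.dom, tp f k = k) →
    (∀ a < Y.dom, Y.ev a = Y.ev (a + 1) → X.ev a ≠ X.ev (a + 1) → a < N ∧ Y.ev a ≤ K) →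
    ∃ (τ : FacePath X Y) (l : List ℕ), l.Pairwise (· ≤ ·) ∧
      (∀ x ∈ l, x ≤ K) ∧ IsChain (fun i => IsD i) l τ ∧ eval τ = f := by
  induction N generalizing K with
  | zero =>
    intro Y f hd ht h
    have hev : ∀ k ≤ X.dom, X.ev k = Y.ev k := by
      intro k
      induction k with
      | zero => intro _; rw [X.ev_zero, Y.ev_zero]
      | succ k ih =>
        intro hk
        have h1 := ih (by omega)
        have h2 := h k (by omega)
        have h3 : X.ev k = X.ev (k + 1) → Y.ev k = Y.ev (k + 1) := fun h3 => by
          have := ev_tp_eq f h3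
          rwa [ht k (by omega), ht (k + 1) hk] at this
        have h4 := X.ev_le_succ k
        have h5 := X.ev_succ_le k
        have h6 := Y.ev_le_succ k
        have h7 := Y.ev_succ_le k
        omega
    obtain rfl : X = Y := obj_ext hd.symm hev
    refine ⟨idPath X, [], List.Pairwise.nil, by simp, IsChain.nil _, ?_⟩
    exact hom_ext fun k hk => by rw [ht k hk, eval_id, tp_id hk]
  | succ N ih =>
    intro Y f hd ht h
    by_cases hN : N < Y.dom ∧ Y.ev N = Y.ev (N + 1) ∧ X.ev N ≠ X.ev (N + 1)
    · obtain ⟨h1, h2, h3⟩ := hN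
      obtain ⟨A, e, he⟩ := exists_dAt Y h1 h2
      have hA := he.dom
      obtain ⟨g, hg, htg⟩ := he.factor f (by
        intro k hk h4
        rw [ht k hk.le, ht (k + 1) hk]
        intro h5
        rcases Nat.lt_or_ge k N with h6 | h6
        · exact h6
        · obtain rfl : k = N := by omega
          exact absurd h4 h3)
      obtain ⟨τ, l, hl, hlN, hτ, hτg⟩ := ih (Y.ev N) g (by omega)
        (fun k hk => by rw [htg k hk, ht k hk]) (by
          intro a ha h4 h5
          rw [he.ev_eq a (by omega), he.ev_eq (a + 1) (by omega)] at h4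
          have h6 := Y.ev_le_succ a
          have h7 := h a (by omega)
          have h8 : a < N → Y.ev a ≤ Y.ev N := fun h => Y.ev_mono h.le
          rw [he.ev_eq a (by omega)]
          split_ifs at h4 ⊢ <;> omega)
      have hK := (h N h1 h2 h3).2
      refine ⟨compPath τ (arrow he.face), l ++ [Y.ev N], pairwise_snoc hl hlN,
        mem_snoc (fun x hx => (hlN x hx).trans hK) hK, hτ.snoc (isD_arrow he rfl), ?_⟩
      rw [eval_comp, eval_arrow, hτg]
      exact hg
    · refine ih K f hd ht (fun a ha h1 h2 => ?_)
      obtain ⟨h3, h4⟩ := h a ha h1 h2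
      exact ⟨lt_of_le_of_ne (Nat.le_of_lt_succ h3) (by rintro rfl; exact hN ⟨ha, h1, h2⟩), h4⟩

lemma exists_factorisation (f : X ⟶ Y) : ∃ p : FacePath X Y, IsFactorisation p ∧ eval p = f := by
  obtain ⟨E, τ, f₁, l₁, hl₁, -, hτ, rfl, h₁⟩ := exists_increasingV Y.dom f
    (fun j h _ => h.2.1)
  -- Every code `2 * c + ε` with `c ≤ E.cod` and `ε ≤ 1` is below this bound.
  obtain ⟨D, ψ, f₂, l₂, hl₂, -, hψ, rfl, h₂⟩ := exists_increasingB (2 * E.cod + 2) f₁ h₁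
    (fun v _ _ => ⟨fun _ _ => by have := E.ev_le v; omega, fun _ _ => by
      have := E.ev_le v; omega⟩)
  obtain ⟨C, δ, f₃, l₃, hl₃, -, hδ, rfl, h₃⟩ := exists_increasingS (D.cod + 1) f₂
    (fun v hv h => ⟨(h₂ v hv h).1, (h₂ v hv h).2, Nat.lt_succ_of_le (D.ev_le v)⟩)
  obtain ⟨hd, ht⟩ := tp_eq_self h₃
  obtain ⟨σ, l₄, hl₄, -, hσ, rfl⟩ := exists_increasingD C.dom C.cod f₃ hd ht
    (fun a ha _ _ => ⟨ha, C.ev_le a⟩)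
  refine ⟨compPath σ (compPath (idPath C) (compPath (idPath C) (compPath δ (compPath ψ τ)))),
    ⟨C, C, C, D, E, σ, idPath C, idPath C, δ, ψ, τ, ⟨l₄, hl₄, hσ⟩,
      ⟨[], List.Pairwise.nil, IsChain.nil _⟩, ⟨[], List.Pairwise.nil, IsChain.nil _⟩,
      ⟨l₃, hl₃, hδ⟩, ⟨l₂, hl₂, hψ⟩, ⟨l₁, hl₁, hτ⟩, rfl⟩, ?_⟩
  simp only [eval_comp, eval_id, Category.id_comp, Category.assoc]

end FatDelta

/-! ### The relations hold in fat Delta. -/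

namespace FatDelta

variable {W X X' Y Z : FatDelta}

lemma SAt.unique {u v : ℕ} {f : X ⟶ Y} (h : SAt v f) (hu : u ≤ Y.dom) (e : Y.ev u = Y.ev v) :
    u = v := by
  rcases Nat.lt_trichotomy u v with h1 | h1 | h1
  · have h2 := h.left (by omega)
    have h3 : Y.ev u ≤ Y.ev (v - 1) := Y.ev_mono (by omega)
    omega
  · exact h1
  · have h2 := h.right (by omega)
    have h3 : Y.ev (v + 1) ≤ Y.ev u := Y.ev_mono h1
    omega

lemma SAt.firstVertex {v : ℕ} {f : X ⟶ Y} (h : SAt v f) : firstVertex Y (Y.ev v) = v :=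
  firstVertex_eq h.le rfl h.left

/-- The source and the index determine the position of the inserted vertex: it is the number of
vertices of `W` in fibres below the index. -/
lemma SAt.position_le {u u' : ℕ} {p : W ⟶ X} {p' : W ⟶ X'} (hp : SAt u p) (hp' : SAt u' p')
    (h : X.ev u = X'.ev u') : u' ≤ u := by
  by_contra h1
  have h2 := hp.dom
  have h3 := hp'.dom
  have h4 := hp'.le
  have h5 := hp.right (by omega)
  have h6 := hp'.left (by omega)
  have h7 : X'.ev u ≤ X'.ev (u' - 1) := X'.ev_mono (by omega)
  have h8 := hp.ev_eq u (by omega)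
  rw [hp'.ev_eq u (by omega), if_pos (by omega), if_neg (lt_irrefl u)] at h8
  omega

section Soundness

variable {p : W ⟶ X} {q : X ⟶ Y} {p' : W ⟶ X'} {q' : X' ⟶ Y}

lemma comp_eq_of_dd {a b c d : ℕ} (hp : DAt a p) (hq : DAt b q) (hp' : DAt c p')
    (hq' : DAt d q') : p ≫ q = p' ≫ q' := by
  have h1 := hp.dom
  have h2 := hp'.dom
  refine hom_ext fun k hk => ?_
  rw [tp_comp, tp_comp, hp.tp_eq k hk, hp'.tp_eq k hk, hq.tp_eq k (by omega),
    hq'.tp_eq k (by omega)]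

/-- A standard vertex is alone in its fibre, so the indices force the positions `w = u` and `x = v +
1`. -/
lemma comp_eq_of_ss {i j u v w x : ℕ} (hij : i ≤ j) (hp : SAt v p) (hv : X.ev v = j)
    (hq : SAt u q) (hu : Y.ev u = i) (hp' : SAt w p') (hw : X'.ev w = i) (hq' : SAt x q')
    (hx : Y.ev x = j + 1) : p ≫ q = p' ≫ q' := by
  have h1 := hp.dom
  have h2 := hp'.dom
  have h3 := hq.dom
  have h4 := hq'.dom
  have h5 := hp.le
  have h6 := hp'.le
  have h7 := hq.le
  have h8 := hq'.le
  have huv : u ≤ v := by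
    by_contra h
    have h9 := hq.left (by omega)
    have h10 : Y.ev v ≤ Y.ev (u - 1) := Y.ev_mono (by omega)
    rw [hq.ev_eq v (by omega), if_pos (by omega)] at hv
    omega
  have h9 : Y.ev (u + 1) ≤ Y.ev (v + 1) := Y.ev_mono (by omega)
  have h10 := hq.right (by omega)
  rw [hq.ev_eq v (by omega), if_neg (by omega)] at hv
  have h11 := hq'.unique (u := v + 1) (by omega) (by omega)
  have hwx : w < x := by
    by_contra h
    have h12 := hq'.right (by omega)
    have h13 : Y.ev (x + 1) ≤ Y.ev (w + 1) := Y.ev_mono (by omega)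
    rw [hq'.ev_eq w (by omega), if_neg (by omega)] at hw
    omega
  rw [hq'.ev_eq w (by omega), if_pos hwx] at hw
  have h12 := hq.unique (u := w) (by omega) (by omega)
  refine hom_ext fun k hk => ?_
  rw [tp_comp, tp_comp, hp.tp_eq k hk, hp'.tp_eq k hk, hq.tp_eq _ (by split_ifs <;> omega),
    hq'.tp_eq _ (by split_ifs <;> omega)]
  split_ifs <;> omega

lemma comp_eq_of_vv {i j : ℕ} (hij : i ≤ j) (hp : VAt j p) (hq : VAt i q) (hp' : VAt i p')
    (hq' : VAt (j + 1) q') : p ≫ q = p' ≫ q' := by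
  have h1 := hp.dom
  have h2 := hp'.dom
  refine hom_ext fun k hk => ?_
  rw [tp_comp, tp_comp, hp.tp_eq k hk, hp'.tp_eq k hk, hq.tp_eq _ (by split_ifs <;> omega),
    hq'.tp_eq _ (by split_ifs <;> omega)]
  split_ifs <;> omega

lemma comp_eq_of_sv_gt {j u v : ℕ} (huj : u < j) (hp : VAt j p) (hq : SAt u q)
    (hp' : SAt v p') (hv : X'.ev v = Y.ev u) (hq' : VAt (j + 1) q') : p ≫ q = p' ≫ q' := by
  have h1 := hp.dom
  have h2 := hp'.dom
  have h3 := hq.dom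
  have h4 := hp'.le
  have h5 := hq'.dom
  rw [hq'.ev_eq v h4] at hv
  have huv : v = u := by
    split_ifs at hv with h6
    · exact hq.unique (by omega) hv
    · have := hq.unique (by omega) hv
      omega
  refine hom_ext fun k hk => ?_
  rw [tp_comp, tp_comp, hp.tp_eq k hk, hp'.tp_eq k hk, hq.tp_eq _ (by split_ifs <;> omega),
    hq'.tp_eq _ (by split_ifs <;> omega)]
  split_ifs <;> omega

lemma comp_eq_of_sv_lt {j u v : ℕ} (huj : j < u) (hp : VAt j p) (hq : SAt u q)
    (hp' : SAt v p') (hv : X'.ev v = Y.ev u) (hq' : VAt j q') : p ≫ q = p' ≫ q' := by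
  have h1 := hp.dom
  have h2 := hp'.dom
  have h3 := hq.dom
  have h4 := hp'.le
  have h5 := hq'.dom
  rw [hq'.ev_eq v h4] at hv
  have huv : v + 1 = u := by
    split_ifs at hv with h6
    · have := hq.unique (by omega) hv
      omega
    · exact hq.unique (by omega) hv
  refine hom_ext fun k hk => ?_
  rw [tp_comp, tp_comp, hp.tp_eq k hk, hp'.tp_eq k hk, hq.tp_eq _ (by split_ifs <;> omega),
    hq'.tp_eq _ (by split_ifs <;> omega)]
  split_ifs <;> omega

lemma comp_eq_of_dv_eq {a b c i j u : ℕ} {s : W ⟶ Z} {d : Z ⟶ X'}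
    (hij : j = firstVertex W (i + 1)) (hp : DAt a p) (ha : X.ev a = i) (hq : VAt j q)
    (hs : SAt u s) (hu : Z.ev u = i + 1) (hd : DAt b d) (hq' : DAt c q') :
    p ≫ q = (s ≫ d) ≫ q' := by
  have h1 := hp.dom
  have h2 := hs.dom
  have h3 := hq.dom
  have h4 := hd.dom
  have h5 := hp.lt
  have h6 := hs.le
  have h7 := hp.marked
  have h8 := hp.ev_eq (a + 1) (by omega)
  rw [if_neg (by omega)] at h8
  -- If `u` were the last vertex of `Z`, all fibre values of `W` would be below `i + 1`, the value
  -- at `a + 1`.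
  have hud : u ≤ W.dom := by
    by_contra h
    have h9 := hs.left (by omega)
    have h10 : Z.ev (a + 1) ≤ Z.ev (u - 1) := Z.ev_mono (by omega)
    rw [hs.ev_eq _ (by omega), if_pos (by omega)] at h8
    omega
  have h9 := hs.right (by omega)
  have h10 := Z.ev_succ_le u
  have hju : j = u := by
    rw [hij]
    refine firstVertex_eq hud ?_ fun h => ?_
    · rw [hs.ev_eq u hud, if_neg (lt_irrefl u)]
      omega
    · have h11 := hs.left h
      rw [hs.ev_eq u hud, if_neg (lt_irrefl u), hs.ev_eq _ (by omega), if_pos (by omega)]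
      omega
  refine hom_ext fun k hk => ?_
  have h11 : (if k < u then k else k + 1) ≤ Z.dom := by split_ifs <;> omega
  rw [tp_comp, tp_comp, tp_comp, hp.tp_eq k hk, hq.tp_eq k (by omega), hs.tp_eq k hk,
    hd.tp_eq _ h11, hq'.tp_eq _ (by omega), hju]

lemma comp_eq_of_dv_ne {a b j : ℕ} (hp : DAt a p) (hq : VAt j q) (hp' : VAt j p')
    (hq' : DAt b q') : p ≫ q = p' ≫ q' := by
  have h1 := hp.dom
  have h2 := hp'.dom
  refine hom_ext fun k hk => ?_
  rw [tp_comp, tp_comp, hp.tp_eq k hk, hp'.tp_eq k hk, hq.tp_eq k (by omega),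
    hq'.tp_eq _ (by split_ifs <;> omega)]

lemma comp_eq_of_sd {a b u : ℕ} (hp : SAt u p) (hq : DAt a q) (hp' : DAt b p')
    (hq' : SAt u q') : p ≫ q = p' ≫ q' := by
  have h1 := hp.dom
  have h2 := hp'.dom
  refine hom_ext fun k hk => ?_
  rw [tp_comp, tp_comp, hp.tp_eq k hk, hp'.tp_eq k hk, hq'.tp_eq k (by omega),
    hq.tp_eq _ (by split_ifs <;> omega)]

lemma comp_eq_of_sd_eq {a b u v : ℕ} (hp : SAt u p) (hq : DAt a q) (hp' : SAt v p')
    (huv : X.ev u = X'.ev v) (hq' : DAt b q') : p ≫ q = p' ≫ q' := by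
  have h1 := hp.dom
  have h2 := hp'.dom
  obtain rfl : u = v := le_antisymm (hp'.position_le hp huv.symm) (hp.position_le hp' huv)
  refine hom_ext fun k hk => ?_
  rw [tp_comp, tp_comp, hp.tp_eq k hk, hp'.tp_eq k hk, hq'.tp_eq _ (by split_ifs <;> omega),
    hq.tp_eq _ (by split_ifs <;> omega)]

end Soundness

lemma IsD.exists_arrow {i : ℕ} {p : FacePath X Y} (h : IsD i p) :
    ∃ (e : Face X Y) (a : ℕ), DAt a e.1 ∧ Y.ev a = i ∧ p = arrow e := by
  obtain ⟨e, he, rfl⟩ := h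
  obtain ⟨a, ha, hi⟩ := isDegeneratedFace_iff.1 he
  exact ⟨e, a, ha, hi, rfl⟩

lemma IsV.exists_arrow {j : ℕ} {p : FacePath X Y} (h : IsV j p) :
    ∃ e : Face X Y, VAt j e.1 ∧ p = arrow e := by
  obtain ⟨e, he, rfl⟩ := h
  exact ⟨e, isVerticalFace_iff.1 he, rfl⟩

lemma IsS.exists_arrow {i : ℕ} {p : FacePath X Y} (h : IsS i p) :
    ∃ (e : Face X Y) (v : ℕ), SAt v e.1 ∧ Y.ev v = i ∧ p = arrow e := by
  obtain ⟨e, he, rfl⟩ := h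
  obtain ⟨v, hv, hi⟩ := isStandardFace_iff.1 he
  exact ⟨e, v, hv, hi, rfl⟩

lemma eval_pair_eq {e : Face W X} {f : Face X Y} {e' : Face W X'} {f' : Face X' Y}
    (h : e.1 ≫ f.1 = e'.1 ≫ f'.1) :
    eval (compPath (arrow e) (arrow f)) = eval (compPath (arrow e') (arrow f')) := by
  rw [eval_comp, eval_comp, eval_arrow, eval_arrow, eval_arrow, eval_arrow, h]

lemma eval_triple_eq {e : Face W X} {f : Face X Y} {s : Face W Z} {d : Face Z X'}
    {f' : Face X' Y} (h : e.1 ≫ f.1 = (s.1 ≫ d.1) ≫ f'.1) :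
    eval (compPath (arrow e) (arrow f)) =
      eval (compPath (compPath (arrow s) (arrow d)) (arrow f')) := by
  rw [eval_comp, eval_comp, eval_comp, eval_arrow, eval_arrow, eval_arrow, eval_arrow,
    eval_arrow, h]

theorem composite_eq_of_fatRel {X Y : FacePaths} {p q : X ⟶ Y} (h : FatRel p q) :
    composite.map p = composite.map q := by
  cases h with
  | dd hij hp hq hp' hq' =>
    obtain ⟨e, a, he, -, rfl⟩ := hp.exists_arrow
    obtain ⟨f, b, hf, -, rfl⟩ := hq.exists_arrow
    obtain ⟨e', a', he', -, rfl⟩ := hp'.exists_arrow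
    obtain ⟨f', b', hf', -, rfl⟩ := hq'.exists_arrow
    exact eval_pair_eq (comp_eq_of_dd he hf he' hf')
  | hh hij hp hq hp' hq' =>
    obtain ⟨e, a, he, ha, rfl⟩ := hp.exists_arrow
    obtain ⟨f, b, hf, hb, rfl⟩ := hq.exists_arrow
    obtain ⟨e', a', he', ha', rfl⟩ := hp'.exists_arrow
    obtain ⟨f', b', hf', hb', rfl⟩ := hq'.exists_arrow
    exact eval_pair_eq (comp_eq_of_ss hij he ha hf hb he' ha' hf' hb')
  | vv hij hp hq hp' hq' =>
    obtain ⟨e, he, rfl⟩ := hp.exists_arrow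
    obtain ⟨f, hf, rfl⟩ := hq.exists_arrow
    obtain ⟨e', he', rfl⟩ := hp'.exists_arrow
    obtain ⟨f', hf', rfl⟩ := hq'.exists_arrow
    exact eval_pair_eq (comp_eq_of_vv hij he hf he' hf')
  | hv_gt hij hp hq hp' hq' =>
    obtain ⟨e, he, rfl⟩ := hp.exists_arrow
    obtain ⟨f, b, hf, rfl, rfl⟩ := hq.exists_arrow
    obtain ⟨e', a', he', ha', rfl⟩ := hp'.exists_arrow
    obtain ⟨f', hf', rfl⟩ := hq'.exists_arrow
    rw [hf.firstVertex] at hij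
    exact eval_pair_eq (comp_eq_of_sv_gt hij he hf he' ha' hf')
  | hv_lt hij hp hq hp' hq' =>
    obtain ⟨e, he, rfl⟩ := hp.exists_arrow
    obtain ⟨f, b, hf, rfl, rfl⟩ := hq.exists_arrow
    obtain ⟨e', a', he', ha', rfl⟩ := hp'.exists_arrow
    obtain ⟨f', hf', rfl⟩ := hq'.exists_arrow
    rw [hf.firstVertex] at hij
    exact eval_pair_eq (comp_eq_of_sv_lt hij he hf he' ha' hf')
  | dv_eq hij hp hq hp' hq' =>
    obtain ⟨e, a, he, ha, rfl⟩ := hp.exists_arrow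
    obtain ⟨f, hf, rfl⟩ := hq.exists_arrow
    obtain ⟨Z, s, d, hs, hd, rfl⟩ := hp'
    obtain ⟨s, u, hsu, hu, rfl⟩ := hs.exists_arrow
    obtain ⟨d, b, hdb, -, rfl⟩ := hd.exists_arrow
    obtain ⟨f', c, hf', -, rfl⟩ := hq'.exists_arrow
    -- The truncated subtraction in `i + 1 - ε + ε` is harmless since `ε ≤ 1`.
    have hu' := hu.trans (Nat.sub_add_cancel (by omega))
    exact eval_triple_eq (comp_eq_of_dv_eq hij he ha hf hsu hu' hdb hf')
  | dv_ne hij hp hq hp' hq' =>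
    obtain ⟨e, a, he, -, rfl⟩ := hp.exists_arrow
    obtain ⟨f, hf, rfl⟩ := hq.exists_arrow
    obtain ⟨e', he', rfl⟩ := hp'.exists_arrow
    obtain ⟨f', b', hf', -, rfl⟩ := hq'.exists_arrow
    exact eval_pair_eq (comp_eq_of_dv_ne he hf he' hf')
  | hd_lt hij hp hq hp' hq' =>
    obtain ⟨e, u, he, hu, rfl⟩ := hp.exists_arrow
    obtain ⟨f, a, hf, ha, rfl⟩ := hq.exists_arrow
    obtain ⟨e', b, he', -, rfl⟩ := hp'.exists_arrow
    obtain ⟨f', v, hf', hv, rfl⟩ := hq'.exists_arrow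
    obtain rfl : u = v := by
      have h1 := hf.dom
      have h2 := he.le
      refine hf'.unique (by omega) ?_
      rw [hf.ev_eq u h2] at hu
      split_ifs at hu with h3
      · omega
      · have := ev_mono Y (le_of_not_ge h3)
        omega
    exact eval_pair_eq (comp_eq_of_sd he hf he' hf')
  | hd_eq hij hp hq hr =>
    obtain ⟨e, u, he, hu, rfl⟩ := hp.exists_arrow
    obtain ⟨f, a, hf, ha, rfl⟩ := hq.exists_arrow
    obtain ⟨Z, s, d, hs, hd, rfl⟩ := hr
    obtain ⟨e', v, he', hv, rfl⟩ := hs.exists_arrow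
    obtain ⟨f', b, hf', -, rfl⟩ := hd.exists_arrow
    exact eval_pair_eq (comp_eq_of_sd_eq he hf he' (hu.trans (hij.trans hv.symm)) hf')
  | hd_gt hij hp hq hp' hq' =>
    obtain ⟨e, u, he, hu, rfl⟩ := hp.exists_arrow
    obtain ⟨f, a, hf, ha, rfl⟩ := hq.exists_arrow
    obtain ⟨e', b, he', -, rfl⟩ := hp'.exists_arrow
    obtain ⟨f', v, hf', hv, rfl⟩ := hq'.exists_arrow
    obtain rfl : u = v := by
      have h1 := hf.dom
      have h2 := he.le
      refine hf'.unique (by omega) ?_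
      rw [hf.ev_eq u h2] at hu
      split_ifs at hu with h3
      · have := ev_mono Y h3
        omega
      · omega
    exact eval_pair_eq (comp_eq_of_sd he hf he' hf')

end FatDelta

/-! ### Confluence, and completeness of the relations. -/

namespace FatDelta

variable {W X Y A B : FatDelta}

lemma Face.exists_position (e : Face X Y) :
    (∃ a, DAt a e.1) ∨ (∃ j, VAt j e.1) ∨ ∃ v, SAt v e.1 := by
  rcases e.2 with ⟨i, h⟩ | ⟨j, h⟩ | ⟨i, h⟩
  · obtain ⟨a, ha, -⟩ := isDegeneratedFace_iff.1 h
    exact Or.inl ⟨a, ha⟩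
  · exact Or.inr (Or.inl ⟨j, isVerticalFace_iff.1 h⟩)
  · obtain ⟨v, hv, -⟩ := isStandardFace_iff.1 h
    exact Or.inr (Or.inr ⟨v, hv⟩)

lemma eqUpToRel_equivalence : Equivalence (EqUpToRel (X := X) (Y := Y)) :=
  (Quotient.compClosure.congruence FatRel).equivalence

lemma EqUpToRel.comp_left {q q' : FacePath A Y} (p : FacePath X A) (h : EqUpToRel q q') :
    EqUpToRel (compPath p q) (compPath p q') :=
  (Quotient.compClosure.congruence FatRel).comp_left p h

lemma EqUpToRel.comp_right {p p' : FacePath X A} (h : EqUpToRel p p') (q : FacePath A Y) :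
    EqUpToRel (compPath p q) (compPath p' q) :=
  (Quotient.compClosure.congruence FatRel).comp_right q h

lemma EqUpToRel.of_fatRel {p q : FacePath X Y} (h : FatRel p q) : EqUpToRel p q :=
  Relation.EqvGen.rel _ _ (HomRel.CompClosure.of h)

/-- Any two factorisations of a morphism through the faces `e` and `e'` can be completed to formal
composites that agree up to the relations. -/
def Confluent (e : Face A Y) (e' : Face B Y) : Prop :=
  ∀ (X : FatDelta) (g : X ⟶ A) (g' : X ⟶ B), g ≫ e.1 = g' ≫ e'.1 →
    ∃ (W : FatDelta) (t : FacePath W A) (t' : FacePath W B) (h : X ⟶ W),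
      EqUpToRel (compPath t (arrow e)) (compPath t' (arrow e')) ∧
        h ≫ eval t = g ∧ h ≫ eval t' = g'

lemma Confluent.symm {e : Face A Y} {e' : Face B Y} (h : Confluent e e') : Confluent e' e := by
  intro X g g' hg
  obtain ⟨W, t, t', k, h1, h2, h3⟩ := h X g' g hg.symm
  exact ⟨W, t', t, k, eqUpToRel_equivalence.symm h1, h3, h2⟩

/-- A factorisation of `g` is enough: the one of `g'` follows because `e'` is monic. -/
lemma confluent_of_isMeet {e : Face A Y} {e' : Face B Y} {t : FacePath W A} {t' : FacePath W B}
    (h : IsMeet (eval t) e.1 (eval t') e'.1)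
    (hr : EqUpToRel (compPath t (arrow e)) (compPath t' (arrow e'))) : Confluent e e' := by
  intro X g g' hg
  obtain ⟨k, hk⟩ := h.2 X g g' hg
  refine ⟨W, t, t', k, hr, hk, eq_of_comp_eq e'.1 ?_⟩
  rw [← hg, ← hk, Category.assoc, Category.assoc, h.1]

lemma confluent_of_square {p : Face W A} {e : Face A Y} {p' : Face W B} {e' : Face B Y}
    (h : IsMeet p.1 e.1 p'.1 e'.1)
    (hr : EqUpToRel (compPath (arrow p) (arrow e)) (compPath (arrow p') (arrow e'))) :
    Confluent e e' := by
  refine confluent_of_isMeet (t := arrow p) (t' := arrow p') ?_ hr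
  rwa [eval_arrow, eval_arrow]

lemma confluent_of_eq {e : Face A Y} {e' : Face B Y} (hd : A.dom = B.dom)
    (hev : ∀ k ≤ A.dom, A.ev k = B.ev k) (ht : ∀ k ≤ A.dom, tp e.1 k = tp e'.1 k) :
    Confluent e e' := by
  obtain rfl := obj_ext hd hev
  obtain rfl : e = e' := Subtype.ext (hom_ext ht)
  intro X g g' hg
  obtain rfl := eq_of_comp_eq e.1 hg
  exact ⟨A, idPath A, idPath A, g, eqUpToRel_equivalence.refl _, Category.comp_id g,
    Category.comp_id g⟩

lemma confluent_dd {a b : ℕ} {e : Face A Y} {e' : Face B Y} (he : DAt a e.1) (he' : DAt b e'.1)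
    (hab : a < b) : Confluent e e' := by
  obtain ⟨W, p, p', hp, hp', hm⟩ := exists_meet_dd he he' hab
  have h1 := he.dom
  have h2 := he'.dom
  have h3 := he'.lt
  refine confluent_of_square (p := hp.face) (p' := hp'.face) hm
    (eqUpToRel_equivalence.symm (EqUpToRel.of_fatRel (FatRel.dd (Y.ev_mono hab.le)
      (isD_arrow hp' ?_) (isD_arrow he' rfl) (isD_arrow hp ?_) (isD_arrow he rfl))))
  · rw [he'.ev_eq a (by omega), if_pos hab.le]
  · rw [he.ev_eq b (by omega), if_neg (not_le.2 hab)]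

lemma confluent_vv {u v : ℕ} {e : Face A Y} {e' : Face B Y} (he : VAt u e.1) (he' : VAt v e'.1)
    (huv : u < v) : Confluent e e' := by
  obtain ⟨w, rfl⟩ := Nat.exists_eq_add_of_lt (Nat.zero_lt_of_lt huv)
  rw [Nat.zero_add] at he' huv
  obtain ⟨W, p, p', hp, hp', hm⟩ := exists_meet_vv he he' (Nat.le_of_lt_succ huv)
  exact confluent_of_square (p := hp.face) (p' := hp'.face) hm (EqUpToRel.of_fatRel
    (FatRel.vv (Nat.le_of_lt_succ huv) (isV_arrow hp) (isV_arrow he) (isV_arrow hp')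
      (isV_arrow he')))

lemma confluent_ss {u v : ℕ} {e : Face A Y} {e' : Face B Y} (he : SAt u e.1) (he' : SAt v e'.1)
    (huv : u < v) : Confluent e e' := by
  obtain ⟨w, rfl⟩ := Nat.exists_eq_add_of_lt (Nat.zero_lt_of_lt huv)
  rw [Nat.zero_add] at he' huv
  have hA := he.dom
  have hB := he'.dom
  have hw := he'.le
  intro X g g' hg
  -- The common composite has a value other than the two deleted vertices, so `Y` has at least
  -- three.
  have hpos : 0 < A.dom := by
    have h1 := he.avoid g 0
    have h2 := he'.avoid g' 0
    rw [← hg] at h2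
    have h3 := tp_le (g ≫ e.1) 0
    omega
  obtain ⟨W, p, p', hp, hp', hm⟩ := exists_meet_ss he he' (Nat.le_of_lt_succ huv) hpos
  have hr := he.right (by omega)
  have h4 : Y.ev (u + 1) ≤ Y.ev (w + 1) := Y.ev_mono huv
  refine confluent_of_square (p := hp.face) (p' := hp'.face) hm (EqUpToRel.of_fatRel
    (FatRel.hh (i := Y.ev u) (j := Y.ev (w + 1) - 1) (by omega) (isS_arrow hp ?_)
      (isS_arrow he rfl) (isS_arrow hp' ?_) (isS_arrow he' (by omega)))) X g g' hg
  · rw [he.ev_eq w (by omega), if_neg (by omega)]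
  · rw [he'.ev_eq u (by omega), if_pos huv]

lemma confluent_sv {u v : ℕ} {e : Face A Y} {e' : Face B Y} (he : SAt u e.1) (he' : VAt v e'.1) :
    Confluent e e' := by
  have hA := he.dom
  have hB := he'.dom
  have hu := he.le
  have hv := he'.pos
  rcases Nat.lt_trichotomy u v with huv | rfl | huv
  · obtain ⟨w, rfl⟩ := Nat.exists_eq_add_of_lt hv
    rw [Nat.zero_add] at he' huv
    obtain ⟨huw, W, p, p', hp, hp', hm⟩ := exists_meet_sv_of_lt he he' (Nat.le_of_lt_succ huv)
    refine confluent_of_square (p := hp.face) (p' := hp'.face) hm (EqUpToRel.of_fatRel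
      (FatRel.hv_gt (i := Y.ev u) (j := w) (by rwa [he.firstVertex]) (isV_arrow hp)
        (isS_arrow he rfl) (isS_arrow hp' ?_) (isV_arrow he')))
    rw [he'.ev_eq u (by have := he'.lt; omega), if_pos huv]
  · have h1 := he.left hv
    have h2 := he.right he'.lt
    have h3 := he'.marked
    omega
  · obtain ⟨w, rfl⟩ := Nat.exists_eq_add_of_lt (Nat.zero_lt_of_lt huv)
    rw [Nat.zero_add] at he huv hu
    obtain ⟨hvw, W, p, p', hp, hp', hm⟩ := exists_meet_sv_of_gt he he' (Nat.le_of_lt_succ huv)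
    refine confluent_of_square (p := hp.face) (p' := hp'.face) hm (EqUpToRel.of_fatRel
      (FatRel.hv_lt (i := Y.ev (w + 1)) (j := v) (by rwa [he.firstVertex]) (isV_arrow hp)
        (isS_arrow he rfl) (isS_arrow hp' ?_) (isV_arrow he')))
    rw [he'.ev_eq w (by omega), if_neg (by omega)]

/-- A marked edge cannot end at a standard vertex, so `v` lies strictly to one side of the edge and
the two operations commute. In particular `hd_eq` is not needed for completeness. -/
lemma confluent_ds {a v : ℕ} {e : Face A Y} {e' : Face B Y} (he : DAt a e.1) (he' : SAt v e'.1) :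
    Confluent e e' := by
  have hA := he.dom
  have hB := he'.dom
  have ha := he.lt
  have hv := he'.le
  have hl := he'.left
  have hr := he'.right
  have hmk := he.marked
  rcases Nat.lt_trichotomy v a with hva | rfl | hva
  · obtain ⟨b, rfl⟩ := Nat.exists_eq_add_of_lt (Nat.zero_lt_of_lt hva)
    rw [Nat.zero_add] at he hva hmk ha
    obtain ⟨W, p, p', hp, hp', hm⟩ := exists_meet_ds_of_lt he he' hva
    have h1 : Y.ev (v + 1) ≤ Y.ev (b + 1) := Y.ev_mono hva
    refine confluent_of_square (p := hp.face) (p' := hp'.face) hm (EqUpToRel.of_fatRel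
      (FatRel.hd_lt (i := Y.ev v) (j := Y.ev (b + 1)) (by omega) (isS_arrow hp ?_)
        (isD_arrow he rfl) (isD_arrow hp' ?_) (isS_arrow he' rfl)))
    · rw [he.ev_eq v (by omega), if_pos hva.le]
    · rw [he'.ev_eq b (by omega), if_neg (by omega)]
  · omega
  · rcases Nat.eq_or_lt_of_le (Nat.succ_le_of_lt hva) with rfl | hva'
    · rw [Nat.succ_eq_add_one, Nat.add_sub_cancel] at hl
      have := hl (Nat.succ_pos a)
      omega
    · obtain ⟨W, p, p', hp, hp', hm⟩ := exists_meet_ds_of_gt he he' hva'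
      have h1 : Y.ev a ≤ Y.ev (v - 1) := Y.ev_mono (by omega)
      -- Unmarking an edge to the left of `v` raises its index in `A` by one, hence `Y.ev v + 1`.
      refine confluent_of_square (p := hp.face) (p' := hp'.face) hm (EqUpToRel.of_fatRel
        (FatRel.hd_gt (i := Y.ev v + 1) (j := Y.ev a) (by omega) (isS_arrow hp ?_)
          (isD_arrow he rfl) (isD_arrow hp' ?_) (isS_arrow he' rfl)))
      · rw [he.ev_eq v (by omega), if_neg (by omega)]
      · rw [he'.ev_eq a (by omega), if_pos hva]

lemma DAt.firstVertex {a : ℕ} {f : X ⟶ Y} (h : DAt a f) : firstVertex X (Y.ev a + 1) = a + 1 := by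
  have h1 := h.dom
  have h2 := h.lt
  have h3 := h.marked
  have h4 := h.ev_eq (a + 1) (by omega)
  rw [if_neg (Nat.not_succ_le_self a)] at h4
  refine firstVertex_eq (by omega) (by omega) fun _ => ?_
  rw [h4, Nat.add_sub_cancel, h.ev_eq a (by omega), if_pos le_rfl]
  omega

lemma confluent_dv_of_adjacent {a w : ℕ} {e : Face A Y} {e' : Face B Y} (he : DAt a e.1)
    (he' : VAt (w + 1) e'.1) (haw : a = w ∨ a = w + 1) : Confluent e e' := by
  obtain ⟨W, Z, s, d, p', hs, hd, hp', hm⟩ := exists_meet_dv_of_adjacent he he' haw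
  have hA := he.dom
  have ha := he.lt
  have hB := he'.dom
  have hv := he'.lt
  have hmk := he'.marked
  rw [Nat.add_sub_cancel] at hmk
  have hZ := hd.dom
  have h1 := Y.ev_le_succ w
  have h2 := Y.ev_le_succ (w + 1)
  have hBw : B.ev w = Y.ev w := by rw [he'.ev_eq w (by omega), if_pos (Nat.lt_succ_self w)]
  have hi : Y.ev a = Y.ev w := by rcases haw with rfl | rfl <;> omega
  have hfv := hp'.firstVertex
  rw [hBw] at hfv
  have hZv : Z.ev (w + 1) = Y.ev w + 1 := by
    rw [hd.ev_eq (w + 1) (by omega), he.ev_eq (w + 1) (by omega)]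
    rcases haw with rfl | rfl <;> split_ifs <;> omega
  -- `ε` records which edge at the inner vertex `e` has unmarked: 0 for the incoming one, 1 for the
  -- outgoing one. The bordering extension deals with the other edge.
  have key : ∀ ε : Fin 2, A.ev (2 * w + 1 - a) = Y.ev w + 1 - ε.val →
      FatRel (compPath (arrow hp'.face) (arrow e'))
        (compPath (compPath (arrow hs.face) (arrow hd.face)) (arrow e)) := fun ε hε =>
    FatRel.dv_eq (i := Y.ev w) (j := w + 1) (ε := ε) hfv.symm (isD_arrow hp' hBw)
      (isV_arrow he')
      ⟨Z, arrow hs.face, arrow hd.face, isS_arrow hs (by rw [hZv]; have := ε.isLt; omega),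
        isD_arrow hd hε, rfl⟩
      (isD_arrow he hi)
  refine confluent_of_isMeet (t := compPath (arrow hs.face) (arrow hd.face))
    (t' := arrow hp'.face) ?_ ?_
  · rw [eval_comp, eval_arrow, eval_arrow, eval_arrow]
    exact hm
  · refine eqUpToRel_equivalence.symm (EqUpToRel.of_fatRel ?_)
    rcases haw with rfl | rfl
    · refine key 0 ?_
      rw [he.ev_eq _ (by omega), if_neg (by omega), show 2 * a + 1 - a = a + 1 by omega,
        Fin.val_zero]
      omega
    · refine key 1 ?_
      rw [he.ev_eq _ (by omega), if_pos (by omega), show 2 * w + 1 - (w + 1) = w by omega,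
        Fin.val_one, Nat.add_sub_cancel]

lemma confluent_dv {a v : ℕ} {e : Face A Y} {e' : Face B Y} (he : DAt a e.1) (he' : VAt v e'.1) :
    Confluent e e' := by
  have hv := he'.pos
  have hB := he'.dom
  have ha := he.lt
  have hmk := he.marked
  have hlt := he'.lt
  by_cases h1 : a = v - 1 ∨ a = v
  · obtain ⟨w, rfl⟩ := Nat.exists_eq_add_of_lt hv
    rw [Nat.zero_add] at he' h1
    exact confluent_dv_of_adjacent he he' h1
  · rcases Nat.lt_or_ge v a with hva | hva
    · obtain ⟨b, rfl⟩ := Nat.exists_eq_add_of_lt (Nat.zero_lt_of_lt hva)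
      rw [Nat.zero_add] at he hva ha
      obtain ⟨W, p, p', hp, hp', hm⟩ := exists_meet_dv_of_lt he he' hva
      have hBb : B.ev b = Y.ev (b + 1) := by rw [he'.ev_eq b (by omega), if_neg (by omega)]
      have hfv := hp'.firstVertex
      rw [hBb] at hfv
      exact confluent_of_square (p := hp.face) (p' := hp'.face) hm
        (eqUpToRel_equivalence.symm (EqUpToRel.of_fatRel (FatRel.dv_ne (i := Y.ev (b + 1))
          (j := v) (by rw [hfv]; exact hva.ne) (isD_arrow hp' hBb) (isV_arrow he')
          (isV_arrow hp) (isD_arrow he rfl))))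
    · have hva' : a + 1 < v := by omega
      obtain ⟨W, p, p', hp, hp', hm⟩ := exists_meet_dv_of_gt he he' hva'
      have hBb : B.ev a = Y.ev a := by rw [he'.ev_eq a (by omega), if_pos (by omega)]
      have hfv := hp'.firstVertex
      rw [hBb] at hfv
      exact confluent_of_square (p := hp.face) (p' := hp'.face) hm
        (eqUpToRel_equivalence.symm (EqUpToRel.of_fatRel (FatRel.dv_ne (i := Y.ev a)
          (j := v) (by rw [hfv]; exact hva'.ne') (isD_arrow hp' hBb) (isV_arrow he')
          (isV_arrow hp) (isD_arrow he rfl))))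

theorem confluent (e : Face A Y) (e' : Face B Y) : Confluent e e' := by
  rcases e.exists_position with ⟨a, he⟩ | ⟨u, he⟩ | ⟨u, he⟩ <;>
    rcases e'.exists_position with ⟨b, he'⟩ | ⟨v, he'⟩ | ⟨v, he'⟩
  · rcases Nat.lt_trichotomy a b with h | rfl | h
    · exact confluent_dd he he' h
    · have h1 := he.dom.symm.trans he'.dom
      exact confluent_of_eq h1 (fun k hk => by rw [he.ev_eq k hk, he'.ev_eq k (h1 ▸ hk)])
        fun k hk => by rw [he.tp_eq k hk, he'.tp_eq k (h1 ▸ hk)]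
    · exact (confluent_dd he' he h).symm
  · exact confluent_dv he he'
  · exact confluent_ds he he'
  · exact (confluent_dv he' he).symm
  · rcases Nat.lt_trichotomy u v with h | rfl | h
    · exact confluent_vv he he' h
    · have h1 := Nat.succ.inj (he.dom.symm.trans he'.dom)
      exact confluent_of_eq h1 (fun k hk => by rw [he.ev_eq k hk, he'.ev_eq k (h1 ▸ hk)])
        fun k hk => by rw [he.tp_eq k hk, he'.tp_eq k (h1 ▸ hk)]
    · exact (confluent_vv he' he h).symm
  · exact (confluent_sv he' he).symm
  · exact (confluent_ds he' he).symm
  · exact confluent_sv he he'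
  · rcases Nat.lt_trichotomy u v with h | rfl | h
    · exact confluent_ss he he' h
    · have h1 := Nat.succ.inj (he.dom.symm.trans he'.dom)
      exact confluent_of_eq h1 (fun k hk => by rw [he.ev_eq k hk, he'.ev_eq k (h1 ▸ hk)])
        fun k hk => by rw [he.tp_eq k hk, he'.tp_eq k (h1 ▸ hk)]
    · exact (confluent_ss he' he h).symm

/-- A weight that increases along every face. -/
def weight (X : FatDelta) : ℕ := 2 * X.dom - X.cod

/-- From source to target, a degenerated face lowers `cod` by one, a vertical face raises `dom` by
one, and a standard face raises both by one; the factor 2 makes the last case a gain. -/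
lemma Face.weight_lt (e : Face X Y) : weight X < weight Y := by
  have h1 := X.ev_dom
  have h2 := Y.ev_dom
  have h3 := X.cod_le_dom
  have h4 := Y.cod_le_dom
  unfold weight
  rcases e.exists_position with ⟨a, h⟩ | ⟨j, h⟩ | ⟨v, h⟩
  · have h5 := h.dom
    have h6 := h.lt
    rw [h.ev_eq _ le_rfl, if_neg (by omega), ← h5] at h1
    omega
  · have h5 := h.dom
    have h6 := h.lt
    rw [h.ev_eq _ le_rfl, if_neg (by omega), ← h5] at h1
    omega
  · have h5 := h.dom
    have h6 := h.le
    have h7 := Y.ev_succ_le X.dom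
    rw [h.ev_eq _ le_rfl] at h1
    rw [h5] at h2
    split_ifs at h1 <;> omega

lemma exists_last_face (p : FacePath X Y) :
    (X = Y ∧ HEq p (idPath X)) ∨
      ∃ (A : FatDelta) (q : FacePath X A) (e : Face A Y), p = compPath q (arrow e) := by
  cases p with
  | nil => exact Or.inl ⟨rfl, HEq.rfl⟩
  | cons q e => exact Or.inr ⟨_, q, e, rfl⟩

lemma weight_le (p : FacePath X Y) : weight X ≤ weight Y := by
  induction h : weight Y using Nat.strong_induction_on generalizing Y with
  | _ n ih =>
    subst h
    rcases exists_last_face p with ⟨rfl, -⟩ | ⟨A, q, e, -⟩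
    · exact le_rfl
    · exact (ih _ e.weight_lt q rfl).trans e.weight_lt.le

/-- Faces raise the weight, so induction on the weight of the target applies to both paths with
their last face removed, even though they then end at different objects. -/
theorem eqUpToRel_of_eval_eq (p q : FacePath X Y) (h : eval p = eval q) : EqUpToRel p q := by
  induction hw : weight Y using Nat.strong_induction_on generalizing X Y with
  | _ n ih =>
    subst hw
    rcases exists_last_face p with ⟨rfl, hp⟩ | ⟨A, p', e, rfl⟩
    · rcases exists_last_face q with ⟨-, hq⟩ | ⟨B, q', e', -⟩
      · rw [eq_of_heq hp, eq_of_heq hq]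
        exact eqUpToRel_equivalence.refl _
      · exact absurd (weight_le q') (not_le.2 e'.weight_lt)
    · rcases exists_last_face q with ⟨rfl, -⟩ | ⟨B, q', e', rfl⟩
      · exact absurd (weight_le p') (not_le.2 e.weight_lt)
      · rw [eval_comp, eval_comp, eval_arrow, eval_arrow] at h
        obtain ⟨W, t, t', k, hr, h1, h2⟩ := confluent e e' X _ _ h
        -- The diamond is closed by a mere morphism `k`; existence of factorisations replaces it by
        -- a formal composite.
        obtain ⟨r, -, rfl⟩ := exists_factorisation k
        rw [← eval_comp] at h1 h2
        have h3 := (ih _ e.weight_lt p' (compPath r t) h1.symm rfl).comp_right (arrow e)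
        have h4 := (ih _ e'.weight_lt (compPath r t') q' h2 rfl).comp_right (arrow e')
        rw [compPath_assoc] at h3 h4
        exact eqUpToRel_equivalence.trans h3
          (eqUpToRel_equivalence.trans (hr.comp_left r) h4)

end FatDelta

theorem mainTheorem1 :
    (∀ (X Y : FatDelta) (f : X ⟶ Y),
      (∃ p : FatDelta.FacePath X Y,
        FatDelta.IsFactorisation p ∧ FatDelta.composite.map p = f) ∧
      ∀ p q : FatDelta.FacePath X Y,
        FatDelta.composite.map p = f → FatDelta.composite.map q = f →
          FatDelta.EqUpToRel p q) ∧
    ∃ relations_hold : ∀ (X Y : FatDelta.FacePaths) (p q : X ⟶ Y), FatDelta.FatRel p q →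
        FatDelta.composite.map p = FatDelta.composite.map q,
      Function.Bijective
        (CategoryTheory.Quotient.lift FatDelta.FatRel FatDelta.composite relations_hold).obj ∧
      (CategoryTheory.Quotient.lift FatDelta.FatRel FatDelta.composite relations_hold).Full ∧
      (CategoryTheory.Quotient.lift FatDelta.FatRel FatDelta.composite relations_hold).Faithful := by
  refine ⟨fun X Y f => ⟨FatDelta.exists_factorisation f, fun p q hp hq =>
    FatDelta.eqUpToRel_of_eval_eq p q (hp.trans hq.symm)⟩,
    fun X Y p q => FatDelta.composite_eq_of_fatRel, ?_, ⟨fun {X Y} f => ?_⟩, ⟨fun {X Y} p q h => ?_⟩⟩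
  · exact ⟨fun X Y h => CategoryTheory.Quotient.ext h, fun X => ⟨⟨X⟩, rfl⟩⟩
  · obtain ⟨p, -, hp⟩ := FatDelta.exists_factorisation (X := X.as) (Y := Y.as) f
    exact ⟨(CategoryTheory.Quotient.functor FatDelta.FatRel).map p, hp⟩
  -- Morphisms of the quotient lift to formal composites, where equality of values implies being
  -- connected by relations.
  · obtain ⟨p, rfl⟩ := (CategoryTheory.Quotient.functor FatDelta.FatRel).map_surjective p
    obtain ⟨q, rfl⟩ := (CategoryTheory.Quotient.functor FatDelta.FatRel).map_surjective q
    exact (CategoryTheory.Quotient.functor_homRel_eq_compClosure_eqvGen FatDelta.FatRel p q).2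
      (FatDelta.eqUpToRel_of_eval_eq p q h)
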